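/- **Model.** Let $p\ge 2$. An instance of the $p$-player problem Max-Card-$k$ consists of a positive integer $k$, a finite ground set $W$ with $N=|W|$ elements, a partition of $W$ into $p$ disjoint (possibly empty) sets $W_1,\dots,W_p$, subsets $V_i\subseteq W_i$ for $i\in\{1,\dots,p\}$, and a non-negative monotone submodular function $f\colon 2^W\to\mathbb{R}_{\ge 0}$. Every player knows $k$, $W$ and the partition; player $i$ moreover knows $V_i$ and can evaluate $f$ on every subset of $W_1\cup\dots\cup W_i$. In a (randomized) one-way protocol, for $i=1,\dots,p-1$ player $i$ computes a bit string $m_i$ from her information, the message $m_{i-1}$ (if $i\ge 2$) and private randomness and sends it to player $i+1$; the last player computes from her information, $m_{p-1}$ and private randomness an output set. There is no bound on the computation time. The protocol has approximation guarantee $\alpha$ if on every instance its output $S$ always satisfies $S\subseteq V_1\cup\dots\cup V_p$ and $|S|\le k$, and $\mathbb{E}[f(S)]\ge\alpha\cdot\max\{f(T): T\subseteq V_1\cup\dots\cup V_p,\ |T|\le k\}$. Its communication complexity is the maximum length in bits of any one of the messages $m_1,\dots,m_{p-1}$, over all instances and the randomness. A (weighted) coverage function is a function $f(S)=\sum_{u\in\bigcup_{v\in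 S}C_v}a(u)$, where the $C_v$ ($v\in W$) are subsets of a finite set $U$ and $a\colon U\to\mathbb{R}_{\ge 0}$. Let $H_p=1+\frac12+\dots+\frac1p$. **Theorem.** There is a universal constant $c>0$ such that the following hold. 1. For every $\varepsilon>0$, every $p\ge 2$ and every finite ground set $W$ with $N=|W|$, any randomized $p$-player one-way protocol for Max-Card-$k$ with approximation guarantee $$\frac{p+(H_p)^2}{2p-H_p}\cdot(1+\varepsilon)$$ has communication complexity at least $c\,N\varepsilon/p^3$. This remains true in the special case in which $f$ is a coverage function and $k=p$, i.e. when both the approximation guarantee is required and the communication complexity is measured only on such instances. 2. $\displaystyle\lim_{p\to\infty}\frac{p+(H_p)^2}{2p-H_p}=\frac12$. Moreover, for every $\varepsilon>0$ there is an integer $p_0\ge 2$ such that for all $p\ge p_0$ and all finite ground sets $W$ with $N=|W|$, any randomized $p$-player one-way protocol for Max-Card-$k$ with $k=p$ that has approximation guarantee $\frac12+\varepsilon$ has communication complexity at least $c\,N\varepsilon/p^3$, and this remains true if, in addition, $f$ is restricted to coverage functions. -/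

import Mathlib

open Filter Topology
open scoped ENNReal

universe u

noncomputable section

namespace MaxCard

/-- A set function is non-negative, monotone and submodular (diminishing marginal values). -/
def IsMonotoneSubmodular {W : Type*} [DecidableEq W] (f : Finset W → ℝ) : Prop :=
  (∀ S, 0 ≤ f S) ∧
  (∀ S T, S ⊆ T → f S ≤ f T) ∧
  (∀ X Y, X ⊆ Y → ∀ v, v ∉ Y → f (insert v Y) - f Y ≤ f (insert v X) - f X)

/-- A (weighted) coverage function: the elements of `W` are subsets of a finite universe (here
`Fin m`) with non-negative weights, and `f S` is the total weight of the points covered by `S`. -/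
def IsCoverage {W : Type*} (f : Finset W → ℝ) : Prop :=
  ∃ (m : ℕ) (a : Fin m → ℝ) (cover : W → Finset (Fin m)),
    (∀ u, 0 ≤ a u) ∧ ∀ S : Finset W, f S = ∑ u ∈ S.biUnion cover, a u

/-- An instance of the `p`-player problem on the ground set `W`. Players are numbered
`0, …, p - 1`; `part v` is the player `i` with `v ∈ W_i`, and player `i` actually gets
`V_i = V ∩ W_i`, so that `V` is the union of the `V_i`. -/
structure Instance (p : ℕ) (W : Type*) where
  /-- the upper bound on the size of a solution -/
  k : ℕ
  /-- the partition of the ground set into `p` (possibly empty) blocks -/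
  part : W → Fin p
  /-- the elements that the players actually get -/
  V : Finset W
  /-- the objective function -/
  f : Finset W → ℝ

/-- What a single player knows: the global information `k`, `part` (and `W`), the player's own
elements, and an oracle for the objective function. -/
structure View (p : ℕ) (W : Type*) where
  /-- the upper bound on the size of a solution -/
  k : ℕ
  /-- the partition of the ground set -/
  part : W → Fin p
  /-- the private elements of the player -/
  own : Finset W
  /-- the oracle -/
  oracle : Finset W → ℝ

namespace Instance

variable {p : ℕ} {W : Type*}

/-- The view of player `i`: besides the global information she knows `V_i` and can evaluate `f`
exactly on the subsets of `W_0 ∪ ⋯ ∪ W_i`; a query `S` is answered by `f (S ∩ (W_0 ∪ ⋯ ∪ W_i))`. -/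
def view (I : Instance p W) (i : ℕ) : View p W where
  k := I.k
  part := I.part
  own := I.V.filter fun v => (I.part v).val = i
  oracle := fun S => I.f (S.filter fun v => (I.part v).val ≤ i)

/-- The feasible solutions: subsets of `V_0 ∪ ⋯ ∪ V_{p-1}` of size at most `k`. -/
def feasible (I : Instance p W) : Finset (Finset W) :=
  I.V.powerset.filter fun S => S.card ≤ I.k

theorem feasible_nonempty (I : Instance p W) : I.feasible.Nonempty :=
  ⟨∅, by simp [feasible]⟩

/-- The optimal value. -/
def opt (I : Instance p W) : ℝ :=
  I.feasible.sup' I.feasible_nonempty I.f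

end Instance

/-- A randomized one-way `p`-player protocol with private coins on the ground set `W`. Player
`i < p - 1` maps her view and the message she received to a distribution over bit strings (the
message that she sends), and the last player maps her view and the message she received to a
distribution over output sets. Only the values `send i` with `i < p - 1` are ever used. -/
structure Protocol (p : ℕ) (W : Type*) where
  /-- the algorithm of player `i < p - 1` -/
  send : ℕ → View p W → List Bool → PMF (List Bool)
  /-- the algorithm of the last player -/
  out : View p W → List Bool → PMF (Finset W)

namespace Protocol

variable {p : ℕ} {W : Type*}

/-- The distribution of the message received by player `i`, that is, of the message sent by player
`i - 1`. The first player receives the empty message. -/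
def message (P : Protocol p W) (I : Instance p W) : ℕ → PMF (List Bool)
  | 0 => PMF.pure []
  | i + 1 => (P.message I i).bind (P.send i (I.view i))

/-- The distribution of the set that the last player outputs. -/
def output (P : Protocol p W) (I : Instance p W) : PMF (Finset W) :=
  (P.message I (p - 1)).bind (P.out (I.view (p - 1)))

/-- `P` has approximation guarantee `α` on the instances in `𝓘`: on each of them the output is
always a feasible solution, and its expected value is at least `α` times the optimal value. -/
def HasApproxGuarantee [Fintype W] (P : Protocol p W) (𝓘 : Set (Instance p W)) (α : ℝ) : Prop :=
  ∀ I ∈ 𝓘, (∀ S ∈ (P.output I).support, S ∈ I.feasible) ∧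
    α * I.opt ≤ ∑ S : Finset W, (P.output I S).toReal * I.f S

/-- The communication complexity of `P` on the instances in `𝓘`: the maximum length in bits of any
of the messages sent by the first `p - 1` players, over the instances in `𝓘` and the randomness. -/
def commComplexity (P : Protocol p W) (𝓘 : Set (Instance p W)) : ℕ∞ :=
  ⨆ I ∈ 𝓘, ⨆ i ∈ Finset.Icc 1 (p - 1), ⨆ m ∈ (P.message I i).support, (m.length : ℕ∞)

end Protocol

/-- All instances: `k` is any positive integer, `f` is any non-negative monotone submodular
function. -/
def allInstances (p : ℕ) (W : Type*) [DecidableEq W] : Set (Instance p W) :=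
  {I | 0 < I.k ∧ IsMonotoneSubmodular I.f}

/-- The instances in which `k` is the number of players. -/
def equalInstances (p : ℕ) (W : Type*) [DecidableEq W] : Set (Instance p W) :=
  {I | I.k = p ∧ IsMonotoneSubmodular I.f}

/-- The instances in which `k` is the number of players and `f` is a coverage function. -/
def coverageInstances (p : ℕ) (W : Type*) : Set (Instance p W) :=
  {I | I.k = p ∧ IsCoverage I.f}

/-- The ratio `(p + H_p ^ 2) / (2 p - H_p)`, where `H_p` is the `p`-th harmonic number. -/
def ratio (p : ℕ) : ℝ :=
  ((p : ℝ) + (harmonic p : ℝ) ^ 2) / (2 * (p : ℝ) - (harmonic p : ℝ))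

end MaxCard

end

noncomputable section

namespace MaxCard

/-! ### The survival probabilities -/

/-! Player `i` holds one element from each of `n` pairs, chosen by `n` bits, and one of her elements
is special. The special elements together cover everything. The function `hardFun` is built so that
player `i`, who cannot query later blocks, sees no difference between the special element and the
other elements of her block (`hardFun_congr`). A short message therefore cannot favour it.

Value of a set without special elements: mass `survival p i = √((p - i) / p)` remains after `i`
special elements, and an ordinary element of block `i` leaves the fraction `stay p i` of each class
`T ≥ i` uncovered. The uncovered mass of a set `S` is then bounded below by products. Replacing each
by the tangent of the exponential at the value for one element per block makes the bound linear in
`S`. The square root is chosen so that an element costs at most `1 / (4 * p)` whatever its block.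
Thus `p` elements cost at most `1 / 4` out of about `3 / 4`, and about `1 / 2` stays uncovered
(`le_sum_uncovered`, `hardFun_le_ratio`).

Communication: outputs are always feasible, so an element can be put out only if all inputs
compatible with its owner's message agree on its coordinate (`toOuterMeasure_mem_le_leakAt`).
Messages of at most `b` bits certify at most `b + 2` coordinates on average (`sum_leak_le`). Special
elements can thus be chosen player by player so that each is put out with probability at most `(b +
2) / n` (`exists_leakAt_le`). The guarantee forces some special element of the first `p - 1` players
to appear with probability at least `ratio p * ε ≥ ε / 2` (`mul_ratio_le_toReal`). A union bound
with `n` about `N / (2 * p)` gives `b` of order `N * ε / p ^ 2`, more than is needed. -/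

/-- The probability that a random point survives the first `i` of `p` special elements. -/
def survival (p i : ℕ) : ℝ := √(((p : ℝ) - i) / p)

/-- The conditional probability of surviving one further step. -/
def stay (p i : ℕ) : ℝ := survival p (i + 1) / survival p i

theorem survival_nonneg (p i : ℕ) : 0 ≤ survival p i := Real.sqrt_nonneg _

theorem survival_zero {p : ℕ} (hp : 0 < p) : survival p 0 = 1 := by
  have : (p : ℝ) ≠ 0 := by positivity
  simp [survival, this]

theorem survival_self (p : ℕ) : survival p p = 0 := by simp [survival]

theorem survival_pos {p i : ℕ} (h : i < p) : 0 < survival p i := by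
  have h1 : (i : ℝ) < p := by exact_mod_cast h
  have h2 : (0 : ℝ) < p := lt_of_le_of_lt (by positivity) h1
  exact Real.sqrt_pos.2 (div_pos (by linarith) h2)

theorem sq_survival {p i : ℕ} (h : i ≤ p) : survival p i ^ 2 = ((p : ℝ) - i) / p := by
  have h1 : (i : ℝ) ≤ p := by exact_mod_cast h
  exact Real.sq_sqrt (div_nonneg (by linarith) (by positivity))

theorem survival_succ_le (p i : ℕ) : survival p (i + 1) ≤ survival p i := by
  apply Real.sqrt_le_sqrt
  push_cast
  gcongr
  linarith

theorem stay_nonneg (p i : ℕ) : 0 ≤ stay p i :=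
  div_nonneg (survival_nonneg _ _) (survival_nonneg _ _)

theorem stay_le_one (p i : ℕ) : stay p i ≤ 1 :=
  div_le_one_of_le₀ (survival_succ_le p i) (survival_nonneg _ _)

theorem survival_mul_stay {p i : ℕ} (h : i < p) :
    survival p i * stay p i = survival p (i + 1) := by
  have := (survival_pos h).ne'
  rw [stay]; field_simp

theorem stay_pos {p i : ℕ} (h : i + 1 < p) : 0 < stay p i :=
  div_pos (survival_pos h) (survival_pos (by omega))

theorem sum_survival_sub {p i : ℕ} (h : i ≤ p) :
    ∑ T ∈ Finset.Ico i p, (survival p T - survival p (T + 1)) = survival p i := by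
  have := Finset.sum_Ico_sub (survival p) h
  rw [survival_self] at this
  rw [← neg_inj, ← Finset.sum_neg_distrib]
  simpa using this

theorem neg_log_survival {p i : ℕ} (h : i < p) :
    -Real.log (survival p i) = Real.log ((p : ℝ) / (p - i : ℕ)) / 2 := by
  rw [survival, Real.log_sqrt, ← neg_div, ← Real.log_inv, inv_div, Nat.cast_sub h.le]
  have h1 : (i : ℝ) < p := by exact_mod_cast h
  exact div_nonneg (by linarith) (by positivity)

/-- With `R = p - (i + 1)` the left side is half of `log ((R + 1) / R)`, and `log x ≤ x - 1`
applies. -/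
theorem neg_log_stay_le {p i : ℕ} (h : i + 1 < p) :
    -Real.log (stay p i) ≤ 1 / (2 * (p - (i + 1) : ℕ)) := by
  have h1 : (0 : ℝ) < (p - (i + 1) : ℕ) := by
    exact_mod_cast Nat.sub_pos_of_lt h
  have h2 : ((p - i : ℕ) : ℝ) = (p - (i + 1) : ℕ) + 1 := by
    exact_mod_cast (by omega : p - i = p - (i + 1) + 1)
  have h0 : (0 : ℝ) < p := by exact_mod_cast (by omega : 0 < p)
  rw [stay, Real.log_div (survival_pos h).ne' (survival_pos (by omega)).ne', neg_sub,
    sub_eq_neg_add, ← neg_neg (Real.log (survival p i)), neg_log_survival h,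
    neg_log_survival (by omega : i < p), ← sub_eq_add_neg, ← sub_div,
    ← Real.log_div (by positivity) (by rw [h2]; positivity), h2]
  have h3 := Real.log_le_sub_one_of_pos
    (show 0 < (p : ℝ) / (p - (i + 1) : ℕ) / (p / ((p - (i + 1) : ℕ) + 1)) by positivity)
  have h4 : (p : ℝ) / (p - (i + 1) : ℕ) / (p / ((p - (i + 1) : ℕ) + 1)) - 1
      = 1 / (p - (i + 1) : ℕ) := by field_simp; ring
  rw [h4] at h3
  calc _ ≤ (1 / ((p - (i + 1) : ℕ) : ℝ)) / 2 := by gcongr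
    _ = _ := by field_simp

/-- The weight with which the tangent at step `T` enters the estimate. -/
def tangentWeight (p T : ℕ) : ℝ := (survival p T - survival p (T + 1)) * survival p (T + 1)

/-- Squares of `survival` decrease in steps of `1 / p`, and `(a - b) * b = (a² - b²) / 2 - (a - b)²
/ 2`. So all tangents have nearly the same weight. -/
theorem tangentWeight_eq {p T : ℕ} (h : T < p) :
    tangentWeight p T = 1 / (2 * p) - (survival p T - survival p (T + 1)) ^ 2 / 2 := by
  have h0 : (p : ℝ) ≠ 0 := by exact_mod_cast (by omega : p ≠ 0)
  have h1 := sq_survival h.le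
  have h2 := sq_survival (show T + 1 ≤ p from h)
  have h3 : survival p T ^ 2 - survival p (T + 1) ^ 2 = 1 / p := by
    rw [h1, h2]; push_cast; field_simp; ring
  rw [tangentWeight]
  have : (1 : ℝ) / (2 * p) = (1 / p) / 2 := by field_simp
  rw [this, ← h3]; ring

theorem tangentWeight_le {p T : ℕ} (h : T < p) : tangentWeight p T ≤ 1 / (2 * p) := by
  rw [tangentWeight_eq h]
  linarith [sq_nonneg (survival p T - survival p (T + 1))]

/-- The quadratic error `(a - b)²` is controlled by `(a - b) * 2b ≤ a² - b² = 1 / p` together with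
`b² = (p - (T + 1)) / p`. -/
theorem le_tangentWeight {p T : ℕ} (h : T + 1 < p) :
    1 / (2 * p) * (1 - 1 / (4 * (p - (T + 1) : ℕ))) ≤ tangentWeight p T := by
  have h0 : (0 : ℝ) < p := by exact_mod_cast (by omega : 0 < p)
  have hR : (0 : ℝ) < (p - (T + 1) : ℕ) := by exact_mod_cast Nat.sub_pos_of_lt h
  have h1 := sq_survival (show T ≤ p by omega)
  have h2 := sq_survival (show T + 1 ≤ p by omega)
  have h3 : (survival p T - survival p (T + 1)) * (survival p T + survival p (T + 1)) = 1 / p := by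
    have : survival p T ^ 2 - survival p (T + 1) ^ 2 = 1 / p := by
      rw [h1, h2]; push_cast; field_simp; ring
    rw [← this]; ring
  have hs := survival_pos h
  have hle := survival_succ_le p T
  have h4 : (survival p T - survival p (T + 1)) * (2 * survival p (T + 1)) ≤ 1 / p := by
    rw [← h3]
    exact mul_le_mul_of_nonneg_left (by linarith) (by linarith)
  have h5 : ((survival p T - survival p (T + 1)) * (2 * survival p (T + 1))) ^ 2 ≤ (1 / (p : ℝ)) ^ 2 :=
    pow_le_pow_left₀ (mul_nonneg (by linarith) (by linarith)) h4 2
  rw [mul_pow, mul_pow, h2] at h5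
  have h6 : ((p : ℝ) - (T + 1 : ℕ)) = (p - (T + 1) : ℕ) := by rw [Nat.cast_sub h.le]
  rw [h6] at h5
  rw [tangentWeight_eq (by omega)]
  set d := (survival p T - survival p (T + 1)) ^ 2
  set R : ℝ := ((p - (T + 1) : ℕ) : ℝ)
  have h7 : d ≤ 1 / (4 * p * R) := by
    rw [le_div_iff₀ (by positivity)]
    have e : d * (2 ^ 2 * (R / p)) = d * (4 * p * R) / p ^ 2 := by field_simp; ring
    rw [e, one_div, inv_pow, div_le_iff₀ (by positivity), inv_mul_cancel₀ (by positivity)] at h5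
    exact h5
  have : 1 / (2 * (p : ℝ)) * (1 - 1 / (4 * R)) = 1 / (2 * p) - 1 / (4 * p * R) / 2 := by
    field_simp
  rw [this]; linarith

/-- There are `R = p - (i + 1)` weights of at most `1 / (2 * p)`, while the logarithm is at most `1
/ (2 * R)`. The cancellation of `R` makes the cost of an element independent of its block, which is
the point of the square root. -/
theorem sum_tangentWeight_mul_le {p i : ℕ} (h : i + 1 < p) :
    (∑ T ∈ Finset.Ico i (p - 1), tangentWeight p T) * -Real.log (stay p i) ≤ 1 / (4 * p) := by
  have h0 : (0 : ℝ) < p := by exact_mod_cast (by omega : 0 < p)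
  have hR : (0 : ℝ) < (p - (i + 1) : ℕ) := by exact_mod_cast Nat.sub_pos_of_lt h
  have h1 : ∑ T ∈ Finset.Ico i (p - 1), tangentWeight p T ≤ (p - (i + 1) : ℕ) * (1 / (2 * p)) := by
    calc _ ≤ ∑ T ∈ Finset.Ico i (p - 1), 1 / (2 * (p : ℝ)) :=
          Finset.sum_le_sum fun T hT => tangentWeight_le (by simp at hT; omega)
      _ = _ := by
          rw [Finset.sum_const, Nat.card_Ico, nsmul_eq_mul]
          congr 2; omega
  calc _ ≤ ((p - (i + 1) : ℕ) * (1 / (2 * p))) * (1 / (2 * (p - (i + 1) : ℕ)) : ℝ) :=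
        mul_le_mul h1 (neg_log_stay_le h)
          (neg_nonneg.2 (Real.log_nonpos (stay_nonneg _ _) (stay_le_one _ _))) (by positivity)
    _ = _ := by field_simp; norm_num

/-- From `p` to `p + 1` each of the `p` terms gains `log ((p + 1) / p) ≥ 1 / (p + 1)`, in total at
least `1 - 1 / (p + 1)`, which is the growth of the left side. -/
theorem sub_harmonic_le_sum_log (p : ℕ) :
    (p : ℝ) - harmonic p ≤ ∑ R ∈ Finset.Ico 1 p, Real.log ((p : ℝ) / R) := by
  induction p with
  | zero => simp
  | succ p ih =>
    rcases Nat.eq_zero_or_pos p with rfl | hp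
    · simp
    have hp' : (0 : ℝ) < p := by exact_mod_cast hp
    have h1 : ∀ R ∈ Finset.Ico 1 (p + 1), Real.log (((p + 1 : ℕ) : ℝ) / R)
        = Real.log ((p : ℝ) / R) + Real.log ((p + 1) / p) := by
      intro R hR
      have : (0 : ℝ) < R := by
        exact_mod_cast (Finset.mem_Ico.1 hR).1
      rw [← Real.log_mul (by positivity) (by positivity)]
      push_cast
      congr 1; field_simp
    rw [Finset.sum_congr rfl h1, Finset.sum_add_distrib, Finset.sum_Ico_succ_top hp,
      div_self hp'.ne', Real.log_one, Finset.sum_const, Nat.card_Ico, nsmul_eq_mul, harmonic_succ]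
    have h2 := Real.log_le_sub_one_of_pos (show 0 < (p : ℝ) / (p + 1) by positivity)
    have h3 : Real.log ((p + 1) / p) = -Real.log ((p : ℝ) / (p + 1)) := by
      rw [← Real.log_inv, inv_div]
    have h4 : (1 : ℝ) / (p + 1) ≤ Real.log ((p + 1) / p) := by
      rw [h3]
      have : (p : ℝ) / (p + 1) - 1 = -(1 / (p + 1)) := by field_simp; ring
      linarith
    have h5 : (p : ℝ) * (1 / (p + 1)) ≤ p * Real.log ((p + 1) / p) := by gcongr
    have h6 : (p : ℝ) * (1 / (p + 1)) = 1 - (p + 1 : ℝ)⁻¹ := by field_simp; ring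
    push_cast
    linarith

theorem sum_one_div_le_harmonic {p : ℕ} :
    ∑ R ∈ Finset.Ico 1 p, (1 : ℝ) / R ≤ harmonic p := by
  rw [harmonic_eq_sum_Icc]
  push_cast
  simp only [one_div]
  apply Finset.sum_le_sum_of_subset_of_nonneg
  · intro x hx; simp at hx ⊢; omega
  · intros; positivity

theorem log_le_harmonic {p : ℕ} (hp : 0 < p) : Real.log p ≤ harmonic p := by
  have h := log_add_one_le_harmonic p
  refine le_trans (Real.log_le_log (by exact_mod_cast hp) ?_) h
  push_cast; linarith

theorem harmonic_cast_nonneg (p : ℕ) : (0 : ℝ) ≤ harmonic p := by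
  have : (0 : ℚ) ≤ harmonic p := by
    unfold harmonic; positivity
  exact_mod_cast this

/-- The main term is `1 / 2 * (1 + 1 / 2)`: the weights are about `1 / (2 * p)`, and with `R = p - 1
- T` the logarithms are `log (p / R) / 2`, of average about `1 / 2`. -/
theorem le_sum_tangentWeight {p : ℕ} (hp : 1 ≤ p) :
    3 / 4 - 1 / (2 * p) * (1 + 3 / 4 * harmonic p + (harmonic p : ℝ) ^ 2 / 8) ≤
      ∑ T ∈ Finset.range (p - 1), tangentWeight p T * (1 - Real.log (survival p (T + 1))) := by
  have h0 : (0 : ℝ) < p := by exact_mod_cast (by omega : 0 < p)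
  set H : ℝ := (harmonic p : ℝ)
  have hH0 : 0 ≤ H := harmonic_cast_nonneg p
  have key : ∀ T ∈ Finset.range (p - 1),
      1 / (2 * p) * (1 + Real.log ((p : ℝ) / (p - 1 - T : ℕ)) / 2
        - (1 + H / 2) / 4 * (1 / (p - 1 - T : ℕ))) ≤
      tangentWeight p T * (1 - Real.log (survival p (T + 1))) := by
    intro T hT
    have hT' : T + 1 < p := by simp at hT; omega
    have hR : (0 : ℝ) < (p - (T + 1) : ℕ) := by exact_mod_cast Nat.sub_pos_of_lt hT'
    have hR1 : (1 : ℝ) ≤ (p - (T + 1) : ℕ) := by exact_mod_cast Nat.sub_pos_of_lt hT'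
    have hRp : ((p - (T + 1) : ℕ) : ℝ) ≤ p := by exact_mod_cast Nat.sub_le _ _
    have e : p - 1 - T = p - (T + 1) := by omega
    rw [e, sub_eq_add_neg (1 : ℝ) (Real.log (survival p (T + 1))), neg_log_survival hT']
    set R : ℝ := ((p - (T + 1) : ℕ) : ℝ)
    set l := Real.log (p / R)
    have hl0 : 0 ≤ l := Real.log_nonneg (by rw [le_div_iff₀ hR]; linarith)
    have hl1 : l ≤ H := by
      refine le_trans ?_ (log_le_harmonic (by omega))
      exact Real.log_le_log (by positivity) (div_le_self h0.le hR1)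
    calc _ ≤ 1 / (2 * p) * (1 - 1 / (4 * R)) * (1 + l / 2) := by
          rw [mul_assoc]
          apply mul_le_mul_of_nonneg_left _ (by positivity)
          have : (1 - 1 / (4 * R)) * (1 + l / 2) = 1 + l / 2 - (1 + l / 2) / 4 * (1 / R) := by
            field_simp
          rw [this]
          gcongr
      _ ≤ _ := mul_le_mul_of_nonneg_right (le_tangentWeight hT') (by positivity)
  refine le_trans ?_ (Finset.sum_le_sum key)
  rw [← Finset.mul_sum]
  have hrefl : ∀ g : ℕ → ℝ, ∑ T ∈ Finset.range (p - 1), g (p - 1 - T) = ∑ R ∈ Finset.Ico 1 p, g R := by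
    intro g
    rw [Finset.sum_Ico_eq_sum_range, ← Finset.sum_range_reflect]
    apply Finset.sum_congr rfl
    intro T hT
    simp at hT
    congr 1; omega
  rw [hrefl fun R => 1 + Real.log ((p : ℝ) / R) / 2 - (1 + H / 2) / 4 * (1 / R),
    Finset.sum_sub_distrib, Finset.sum_add_distrib, ← Finset.sum_div, ← Finset.mul_sum]
  have h1 := sub_harmonic_le_sum_log p
  have h2 : (1 + H / 2) / 4 * ∑ R ∈ Finset.Ico 1 p, (1 : ℝ) / R ≤ (1 + H / 2) / 4 * H := by
    gcongr; exact sum_one_div_le_harmonic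
  have h3 : ∑ R ∈ Finset.Ico 1 p, (1 : ℝ) = p - 1 := by
    simp [Nat.cast_sub hp]
  rw [h3]
  calc _ = 1 / (2 * p) * ((p - 1) + (p - H) / 2 - (1 + H / 2) / 4 * H) := by field_simp; ring
    _ ≤ _ := by
      apply mul_le_mul_of_nonneg_left _ (by positivity)
      linarith

/-- This is `exp` above its tangent at `log (survival p (T + 1))`. The bound on `T` keeps every
`stay` positive; in the last block `stay` is `0` and its logarithm has a junk value. -/
theorem survival_mul_tangent_le {W : Type*} {p T : ℕ} (part : W → Fin p) (S : Finset W)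
    (hT : T + 1 < p) :
    survival p (T + 1) * (1 - Real.log (survival p (T + 1))
        + ∑ v ∈ S with (part v).val ≤ T, Real.log (stay p (part v))) ≤
      ∏ v ∈ S with (part v).val ≤ T, stay p (part v) := by
  have hs := survival_pos hT
  have h : ∏ v ∈ S with (part v).val ≤ T, stay p (part v)
      = survival p (T + 1) * Real.exp (-Real.log (survival p (T + 1))
        + ∑ v ∈ S with (part v).val ≤ T, Real.log (stay p (part v))) := by
    rw [Real.exp_add, Real.exp_neg, Real.exp_log hs, Real.exp_sum, mul_inv_cancel_left₀ hs.ne']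
    refine Finset.prod_congr rfl fun v hv => (Real.exp_log (stay_pos ?_)).symm
    have := (Finset.mem_filter.1 hv).2
    omega
  rw [h]
  refine mul_le_mul_of_nonneg_left ?_ hs.le
  refine le_trans (le_of_eq ?_) (Real.add_one_le_exp _)
  ring

/-- The total weight that a set of `p` ordinary elements leaves uncovered. -/
theorem le_sum_uncovered {W : Type*} {p : ℕ} (hp : 1 ≤ p) (part : W → Fin p) (S : Finset W)
    (hS : S.card ≤ p) :
    1 / 2 - 1 / (2 * p) * (1 + 3 / 4 * harmonic p + (harmonic p : ℝ) ^ 2 / 8) ≤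
      ∑ T ∈ Finset.range (p - 1), (survival p T - survival p (T + 1)) *
        ∏ v ∈ S with (part v).val ≤ T, stay p (part v) := by
  have h0 : (0 : ℝ) < p := by exact_mod_cast (by omega : 0 < p)
  have h1 : ∑ T ∈ Finset.range (p - 1), tangentWeight p T * (1 - Real.log (survival p (T + 1))
      + ∑ v ∈ S with (part v).val ≤ T, Real.log (stay p (part v))) ≤
      ∑ T ∈ Finset.range (p - 1), (survival p T - survival p (T + 1)) *
        ∏ v ∈ S with (part v).val ≤ T, stay p (part v) := by
    refine Finset.sum_le_sum fun T hT => ?_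
    rw [tangentWeight, mul_assoc]
    refine mul_le_mul_of_nonneg_left (survival_mul_tangent_le part S ?_)
      (sub_nonneg.2 (survival_succ_le p T))
    simp at hT; omega
  refine le_trans ?_ h1
  simp only [mul_add (tangentWeight p _)]
  rw [Finset.sum_add_distrib]
  have h2 := le_sum_tangentWeight hp
  -- After exchanging the sums, each `v` in block `i` is charged for all `T ≥ i`. Elements of the
  -- last block are never charged, since `T < p - 1`.
  have h3 : -(1 / 4 : ℝ) ≤ ∑ T ∈ Finset.range (p - 1), tangentWeight p T *
      ∑ v ∈ S with (part v).val ≤ T, Real.log (stay p (part v)) := by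
    simp only [Finset.sum_filter, Finset.mul_sum]
    rw [Finset.sum_comm, neg_le, ← Finset.sum_neg_distrib]
    calc _ ≤ ∑ v ∈ S, 1 / (4 * (p : ℝ)) := by
          refine Finset.sum_le_sum fun v _ => ?_
          by_cases hv : (part v).val + 1 < p
          · refine le_trans (le_of_eq ?_) (sum_tangentWeight_mul_le hv)
            simp only [mul_ite, mul_zero, ← Finset.sum_filter]
            rw [← Finset.sum_mul, mul_neg]
            congr 3
            ext T; simp; omega
          · rw [Finset.sum_eq_zero, neg_zero]
            · positivity
            · intro T hT
              rw [if_neg, mul_zero]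
              simp at hT; omega
      _ = S.card * (1 / (4 * (p : ℝ))) := by rw [Finset.sum_const, nsmul_eq_mul]
      _ ≤ p * (1 / (4 * (p : ℝ))) := by gcongr
      _ = _ := by field_simp
  linarith

/-! ### The ratio -/

theorem harmonic_cast_le {p : ℕ} : (harmonic p : ℝ) ≤ p := by
  have : harmonic p ≤ p := by
    unfold harmonic
    calc _ ≤ ∑ i ∈ Finset.range p, (1 : ℚ) := by
          refine Finset.sum_le_sum fun i _ => inv_le_one_of_one_le₀ ?_
          push_cast; linarith [(Nat.cast_nonneg i : (0 : ℚ) ≤ i)]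
      _ = p := by simp
  exact_mod_cast this

theorem le_ratio {p : ℕ} (hp : 1 ≤ p) :
    1 / 2 + 1 / (2 * p) * ((harmonic p : ℝ) ^ 2 + harmonic p / 2) ≤ ratio p := by
  have h0 : (0 : ℝ) < p := by exact_mod_cast (by omega : 0 < p)
  have h1 := harmonic_cast_le (p := p)
  have h2 := harmonic_cast_nonneg p
  rw [ratio]
  set H : ℝ := (harmonic p : ℝ)
  rw [le_div_iff₀ (by linarith)]
  have : (1 / 2 + 1 / (2 * p) * (H ^ 2 + H / 2)) * (2 * p - H)
      = p + H ^ 2 - H * (H ^ 2 + H / 2) / (2 * p) := by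
    field_simp; ring
  rw [this]
  have : 0 ≤ H * (H ^ 2 + H / 2) / (2 * p) := by positivity
  linarith

theorem half_le_ratio {p : ℕ} (hp : 1 ≤ p) : 1 / 2 ≤ ratio p := by
  refine le_trans ?_ (le_ratio hp)
  have h2 := harmonic_cast_nonneg p
  have : 0 ≤ 1 / (2 * (p : ℝ)) * ((harmonic p : ℝ) ^ 2 + harmonic p / 2) := by positivity
  linarith

theorem three_halves_le_harmonic {p : ℕ} (hp : 2 ≤ p) : (3 / 2 : ℝ) ≤ harmonic p := by
  have : (3 / 2 : ℚ) ≤ harmonic p := by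
    induction p, hp using Nat.le_induction with
    | base => norm_num [harmonic, Finset.sum_range_succ]
    | succ n _ ih =>
      rw [harmonic_succ]
      have : (0 : ℚ) ≤ ((n + 1 : ℕ) : ℚ)⁻¹ := by positivity
      linarith
  have h : ((3 / 2 : ℚ) : ℝ) ≤ harmonic p := by exact_mod_cast this
  push_cast at h
  exact h

/-- The comparison reduces to `1 + H / 4 ≤ 7 / 8 * H ^ 2`, which holds from `H = 3 / 2` on but fails
for `p = 1`. -/
theorem one_sub_ratio_le {p : ℕ} (hp : 2 ≤ p) :
    1 - ratio p ≤
      1 / 2 - 1 / (2 * p) * (1 + 3 / 4 * harmonic p + (harmonic p : ℝ) ^ 2 / 8) := by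
  have h1 := le_ratio (show 1 ≤ p by omega)
  have h2 := three_halves_le_harmonic hp
  set H : ℝ := (harmonic p : ℝ)
  have h3 : 1 / (2 * (p : ℝ)) * (1 + 3 / 4 * H + H ^ 2 / 8) ≤ 1 / (2 * p) * (H ^ 2 + H / 2) := by
    refine mul_le_mul_of_nonneg_left ?_ (by positivity)
    nlinarith
  linarith

theorem tendsto_ratio : Tendsto ratio atTop (𝓝 (1 / 2)) := by
  have hlog : Tendsto (fun p : ℕ => (1 + Real.log p) ^ 2 / (p : ℝ)) atTop (𝓝 0) := by
    have h1 : Tendsto (fun x : ℝ => (1 + Real.log x) ^ 2 / x) atTop (𝓝 0) := by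
      have a1 := Real.isLittleO_log_id_atTop
      have a2 : (fun x : ℝ => Real.log x ^ 2) =o[atTop] (fun x : ℝ => x) :=
        Real.isLittleO_pow_log_id_atTop
      have t0 : Tendsto (fun x : ℝ => 1 / x) atTop (𝓝 0) := by
        simpa using tendsto_inv_atTop_zero (𝕜 := ℝ)
      have t1 : Tendsto (fun x : ℝ => Real.log x / x) atTop (𝓝 0) := a1.tendsto_div_nhds_zero
      have t2 : Tendsto (fun x : ℝ => Real.log x ^ 2 / x) atTop (𝓝 0) := a2.tendsto_div_nhds_zero
      have := (t0.add (t1.const_mul 2)).add t2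
      simp only [mul_zero, add_zero] at this
      refine this.congr fun x => ?_
      ring
    exact h1.comp tendsto_natCast_atTop_atTop
  have hlog1 : Tendsto (fun p : ℕ => (1 + Real.log p) / (p : ℝ)) atTop (𝓝 0) := by
    have t0 : Tendsto (fun x : ℝ => 1 / x) atTop (𝓝 0) := by
      simpa using tendsto_inv_atTop_zero (𝕜 := ℝ)
    have t1 : Tendsto (fun x : ℝ => Real.log x / x) atTop (𝓝 0) :=
      Real.isLittleO_log_id_atTop.tendsto_div_nhds_zero
    have := (t0.add t1).comp (tendsto_natCast_atTop_atTop (R := ℝ))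
    simp only [add_zero] at this
    refine this.congr fun x => ?_
    simp only [Function.comp]
    ring
  have hH : Tendsto (fun p : ℕ => (harmonic p : ℝ) / (p : ℝ)) atTop (𝓝 0) :=
    squeeze_zero (fun p => div_nonneg (harmonic_cast_nonneg p) (by positivity))
      (fun p => div_le_div_of_nonneg_right (harmonic_le_one_add_log p) (by positivity)) hlog1
  have hH2 : Tendsto (fun p : ℕ => (harmonic p : ℝ) ^ 2 / (p : ℝ)) atTop (𝓝 0) :=
    squeeze_zero (fun p => by positivity)
      (fun p => div_le_div_of_nonneg_right
        (pow_le_pow_left₀ (harmonic_cast_nonneg p) (harmonic_le_one_add_log p) 2)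
        (by positivity)) hlog
  have h := (hH2.const_add 1).div (hH.const_sub 2) (by norm_num)
  simp only [add_zero, sub_zero] at h
  refine h.congr' ?_
  filter_upwards [eventually_gt_atTop 0] with p hp
  have : (p : ℝ) ≠ 0 := by positivity
  have h1 : 2 * (p : ℝ) - harmonic p ≠ 0 := by
    have h1 := harmonic_cast_le (p := p)
    have : (0 : ℝ) < p := by positivity
    linarith
  simp only [Pi.div_apply, ratio]
  field_simp

/-! ### The hard objective functions -/

theorem isCoverage_of_fintype {W U : Type*} [Fintype U] (a : U → ℝ) (C : W → U → Prop)
    [∀ v u, Decidable (C v u)] (ha : ∀ u, 0 ≤ a u) {f : Finset W → ℝ}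
    (hf : ∀ S, f S = ∑ u with ∃ v ∈ S, C v u, a u) : IsCoverage f := by
  classical
  let e := (Fintype.equivFin U).symm
  refine ⟨Fintype.card U, fun i => a (e i), fun v => Finset.univ.filter fun i => C v (e i),
    fun i => ha _, fun S => ?_⟩
  rw [hf, Finset.sum_filter, ← e.sum_comp, ← Finset.sum_filter]
  apply Finset.sum_congr _ fun _ _ => rfl
  ext i
  simp

/-- The elements of `S` in the blocks `0, …, T` that are not special. -/
def ordinary {p : ℕ} {W : Type*} [DecidableEq W] (part : W → Fin p) (o : ℕ → W) (T : ℕ)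
    (S : Finset W) : Finset W :=
  S.filter fun v => (part v).val ≤ T ∧ v ≠ o (part v)

/-- The probability that a random point which the special element `o T` is the first to cover is
not covered by `S`. -/
def missProb {p : ℕ} {W : Type*} [DecidableEq W] (part : W → Fin p) (o : ℕ → W) (T : ℕ)
    (S : Finset W) : ℝ :=
  if o T ∈ S then 0 else ∏ v ∈ ordinary part o T S, stay p (part v)

/-- The probability that a random point is covered by `S`: with probability
`survival p T - survival p (T + 1)` it is covered by no special element but `o T`, and then every
ordinary element `v` of the blocks `0, …, T` independently fails to cover it with probability
`stay p (part v)`, while the later ones do not cover it. -/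
def hardFun {p : ℕ} {W : Type*} [DecidableEq W] (part : W → Fin p) (o : ℕ → W) (S : Finset W) : ℝ :=
  ∑ T ∈ Finset.range p, (survival p T - survival p (T + 1)) * (1 - missProb part o T S)

section

variable {p : ℕ} {W : Type*} [DecidableEq W]

theorem missProb_nonneg (part : W → Fin p) (o : ℕ → W) (T : ℕ) (S : Finset W) :
    0 ≤ missProb part o T S := by
  rw [missProb]
  split_ifs
  · rfl
  · exact Finset.prod_nonneg fun v _ => stay_nonneg _ _

theorem hardFun_le_one (hp : 0 < p) (part : W → Fin p) (o : ℕ → W) (S : Finset W) :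
    hardFun part o S ≤ 1 := by
  rw [← survival_zero hp, ← sum_survival_sub (Nat.zero_le p), hardFun, Finset.range_eq_Ico]
  refine Finset.sum_le_sum fun T _ => ?_
  refine mul_le_of_le_one_right (sub_nonneg.2 (survival_succ_le p T)) ?_
  linarith [missProb_nonneg part o T S]

theorem hardFun_eq_one (hp : 0 < p) (part : W → Fin p) (o : ℕ → W) {S : Finset W}
    (hS : ∀ T < p, o T ∈ S) : hardFun part o S = 1 := by
  rw [← survival_zero hp, ← sum_survival_sub (Nat.zero_le p), hardFun, Finset.range_eq_Ico]
  refine Finset.sum_congr rfl fun T hT => ?_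
  rw [missProb, if_pos (hS T (Finset.mem_Ico.1 hT).2), sub_zero, mul_one]

theorem hardFun_eq_one_sub (hp : 0 < p) (part : W → Fin p) (o : ℕ → W) (S : Finset W) :
    hardFun part o S = 1 - ∑ T ∈ Finset.range p,
      (survival p T - survival p (T + 1)) * missProb part o T S := by
  rw [← survival_zero hp, ← sum_survival_sub (Nat.zero_le p), hardFun, Finset.range_eq_Ico,
    ← Finset.sum_sub_distrib]
  refine Finset.sum_congr rfl fun T _ => ?_
  ring

/-- A set of `p` elements that contains none of the special elements of the first `p - 1` blocks
has small value. -/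
theorem hardFun_le_ratio (hp : 2 ≤ p) (part : W → Fin p) (o : ℕ → W) {S : Finset W}
    (hS : S.card ≤ p) (ho : ∀ T < p - 1, o T ∉ S) : hardFun part o S ≤ ratio p := by
  have h1 := (one_sub_ratio_le hp).trans (le_sum_uncovered (by omega) part S hS)
  rw [hardFun_eq_one_sub (by omega)]
  -- The class `T = p - 1` is given away, because `S` may contain the last special element.
  suffices h : ∑ T ∈ Finset.range (p - 1), (survival p T - survival p (T + 1)) *
        ∏ v ∈ S with (part v).val ≤ T, stay p (part v) ≤
      ∑ T ∈ Finset.range p, (survival p T - survival p (T + 1)) * missProb part o T S by linarith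
  calc _ ≤ ∑ T ∈ Finset.range (p - 1),
        (survival p T - survival p (T + 1)) * missProb part o T S := by
        refine Finset.sum_le_sum fun T hT => ?_
        refine mul_le_mul_of_nonneg_left ?_ (sub_nonneg.2 (survival_succ_le p T))
        rw [missProb, if_neg (ho T (Finset.mem_range.1 hT))]
        refine Finset.prod_le_prod_of_subset_of_le_one ?_ ?_ ?_
        · intro v hv
          simp only [ordinary, Finset.mem_filter] at hv ⊢
          exact ⟨hv.1, hv.2.1⟩
        · exact fun v _ => stay_nonneg _ _
        · exact fun v _ _ => stay_le_one _ _
    _ ≤ _ := by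
        refine Finset.sum_le_sum_of_subset_of_nonneg ?_ ?_
        · exact Finset.range_mono (Nat.sub_le _ _)
        · exact fun T _ _ => mul_nonneg (sub_nonneg.2 (survival_succ_le p T))
            (missProb_nonneg _ _ _ _)

/-- The value of a set in the first `i + 1` blocks does not depend on the special element of
block `i` or of any later block. -/
theorem sum_mul_missProb (part : W → Fin p) {o : ℕ → W} {i : ℕ} (hi : i < p)
    (ho : ∀ T < p, (part (o T)).val = T) {S : Finset W} (hS : ∀ v ∈ S, (part v).val ≤ i) :
    ∑ T ∈ Finset.range p, (survival p T - survival p (T + 1)) * missProb part o T S =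
      ∑ T ∈ Finset.range i, (survival p T - survival p (T + 1)) * missProb part o T S +
      survival p i * ((∏ v ∈ S with (part v).val < i ∧ v ≠ o (part v), stay p (part v)) *
        ∏ v ∈ S with (part v).val = i, stay p (part v)) := by
  classical
  set Q := ∏ v ∈ S with (part v).val < i ∧ v ≠ o (part v), stay p (part v)
  set A := ∏ v ∈ S with (part v).val = i ∧ v ≠ o i, stay p (part v) with hA
  have hord : ∀ T, i ≤ T → ∏ v ∈ ordinary part o T S, stay p (part v) = Q * A := by
    intro T hT
    rw [← Finset.prod_union]
    · congr 1
      ext v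
      simp only [ordinary, Finset.mem_filter, Finset.mem_union]
      constructor
      · rintro ⟨h1, h2, h3⟩
        rcases (hS v h1).lt_or_eq with h | h
        · exact Or.inl ⟨h1, h, h3⟩
        · exact Or.inr ⟨h1, h, by rwa [h] at h3⟩
      · rintro (⟨h1, h2, h3⟩ | ⟨h1, h2, h3⟩)
        · exact ⟨h1, by omega, h3⟩
        · exact ⟨h1, by omega, by rwa [h2]⟩
    · rw [Finset.disjoint_filter]
      rintro v - h1 h2
      omega
  have hlater : ∑ T ∈ Finset.Ico (i + 1) p, (survival p T - survival p (T + 1)) *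
      missProb part o T S = survival p (i + 1) * (Q * A) := by
    rw [← sum_survival_sub (show i + 1 ≤ p from hi), Finset.sum_mul]
    refine Finset.sum_congr rfl fun T hT => ?_
    rw [Finset.mem_Ico] at hT
    rw [missProb, if_neg, hord T (by omega)]
    intro h
    have := hS _ h
    rw [ho T hT.2] at this
    omega
  -- If `o i ∈ S`, class `i` is lost and the mass `survival p (i + 1) = survival p i * stay p i` of
  -- later classes is left. The factor `stay p i` is what an ordinary element of block `i` would
  -- contribute.
  have hB : ∏ v ∈ S with (part v).val = i, stay p (part v) =
      (if o i ∈ S then stay p i else 1) * A := by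
    have e : (S.filter fun v => (part v).val = i ∧ v ≠ o i)
        = (S.filter fun v => (part v).val = i).erase (o i) := by
      ext v; simp only [Finset.mem_filter, Finset.mem_erase]; tauto
    rw [hA, e]
    split_ifs with h
    · rw [← Finset.mul_prod_erase _ _ (Finset.mem_filter.2 ⟨h, ho i hi⟩), ho i hi]
    · rw [Finset.erase_eq_of_notMem, one_mul]
      exact fun h' => h (Finset.mem_filter.1 h').1
  rw [Finset.range_eq_Ico, ← Finset.sum_Ico_consecutive _ (Nat.zero_le i) hi.le,
    ← Finset.range_eq_Ico, Finset.sum_eq_sum_Ico_succ_bot hi, hlater, hB, missProb, hord i le_rfl, ← survival_mul_stay hi]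
  split_ifs <;> ring

/-- In `sum_mul_missProb` the right side involves `o T` only for `T < i`. -/
theorem hardFun_congr (part : W → Fin p) {o o' : ℕ → W} {i : ℕ} (hi : i < p)
    (ho : ∀ T < p, (part (o T)).val = T) (ho' : ∀ T < p, (part (o' T)).val = T)
    (h : ∀ T < i, o T = o' T) {S : Finset W} (hS : ∀ v ∈ S, (part v).val ≤ i) :
    hardFun part o S = hardFun part o' S := by
  rw [hardFun_eq_one_sub (by omega), hardFun_eq_one_sub (by omega),
    sum_mul_missProb part hi ho hS, sum_mul_missProb part hi ho' hS]
  have h1 : ∀ T < i, missProb part o T S = missProb part o' T S := by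
    intro T hT
    rw [missProb, missProb, h T hT]
    have : ordinary part o T S = ordinary part o' T S := by
      refine Finset.filter_congr fun v _ => and_congr_right fun hv => ?_
      rw [h _ (by omega)]
    rw [this]
  have h2 : (S.filter fun v => (part v).val < i ∧ v ≠ o (part v))
      = S.filter fun v => (part v).val < i ∧ v ≠ o' (part v) :=
    Finset.filter_congr fun v _ => and_congr_right fun hv => by rw [h _ hv]
  rw [h2, Finset.sum_congr rfl fun T hT => by rw [h1 T (Finset.mem_range.1 hT)]]

/-- The product measure on the subsets of `W` gives the family of sets that miss `A` the product
of the probabilities of missing each element. -/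
theorem sum_prod_disjoint [Fintype W] (s : W → ℝ) (A : Finset W) :
    ∑ Y : Finset W with Disjoint A Y, (∏ v ∈ Y, (1 - s v)) * ∏ v ∈ Finset.univ \ Y, s v =
      ∏ v ∈ A, s v := by
  -- Expanding the product with presence probability `0` on `A` kills exactly the terms of sets
  -- meeting `A`.
  have h := Finset.prod_add (fun v => if v ∈ A then 0 else 1 - s v) s Finset.univ
  rw [Finset.powerset_univ] at h
  have h1 : ∏ v, ((if v ∈ A then 0 else 1 - s v) + s v) = ∏ v ∈ A, s v := by
    rw [← Finset.prod_subset (Finset.subset_univ A)]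
    · exact Finset.prod_congr rfl fun v hv => by simp [hv]
    · intro v _ hv; simp [hv]
  rw [← h1, h, Finset.sum_filter]
  refine Finset.sum_congr rfl fun Y _ => ?_
  split_ifs with hY
  · congr 1
    refine Finset.prod_congr rfl fun v hv => ?_
    rw [if_neg (Finset.disjoint_right.1 hY hv)]
  · obtain ⟨v, hv, hv'⟩ := Finset.not_disjoint_iff.1 hY
    rw [Finset.prod_eq_zero hv' (by rw [if_pos hv]), zero_mul]

/-- A point is a pair `(T, Y)`: `o T` is the only special element covering it, and `Y`, drawn from a
product measure, decides which ordinary elements of the blocks `0, …, T` do. -/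
theorem isCoverage_hardFun [Fintype W] (part : W → Fin p) (o : ℕ → W)
    (ho : ∀ T < p, (part (o T)).val = T) : IsCoverage (hardFun part o) := by
  classical
  set μ : Finset W → ℝ := fun Y =>
    (∏ v ∈ Y, (1 - stay p (part v))) * ∏ v ∈ Finset.univ \ Y, stay p (part v)
  have hμ0 : ∀ Y, 0 ≤ μ Y := fun Y => mul_nonneg
    (Finset.prod_nonneg fun v _ => sub_nonneg.2 (stay_le_one _ _))
    (Finset.prod_nonneg fun v _ => stay_nonneg _ _)
  refine isCoverage_of_fintype (U := Fin p × Finset W)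
    (fun u => (survival p u.1 - survival p (u.1 + 1)) * μ u.2)
    (fun v u => if v = o (part v) then part v = u.1 else part v ≤ u.1 ∧ v ∈ u.2)
    (fun u => mul_nonneg (sub_nonneg.2 (survival_succ_le p _)) (hμ0 _)) fun S => ?_
  rw [hardFun, Finset.sum_range, Finset.sum_filter, Fintype.sum_prod_type]
  refine Finset.sum_congr rfl fun T _ => ?_
  simp only [← mul_ite_zero]
  rw [← Finset.mul_sum]
  congr 1
  have htot : ∑ Y, μ Y = 1 := by
    have := sum_prod_disjoint (fun v => stay p (part v)) ∅
    simpa using this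
  have hcov : ∀ Y : Finset W,
      (∃ v ∈ S, if v = o (part v) then part v = T else part v ≤ T ∧ v ∈ Y) ↔
        o T ∈ S ∨ ¬ Disjoint (ordinary part o T S) Y := by
    intro Y
    constructor
    · rintro ⟨v, hv, h⟩
      split_ifs at h with hvo
      · left; rw [← h, ← hvo]; exact hv
      · right
        exact Finset.not_disjoint_iff.2 ⟨v, Finset.mem_filter.2 ⟨hv, h.1, hvo⟩, h.2⟩
    · rintro (h | h)
      · refine ⟨o T, h, ?_⟩
        have hT := ho T T.2
        rw [hT, if_pos rfl]
        exact Fin.ext hT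
      · obtain ⟨v, hv, hvY⟩ := Finset.not_disjoint_iff.1 h
        obtain ⟨hvS, hvT, hvo⟩ := Finset.mem_filter.1 hv
        exact ⟨v, hvS, by rw [if_neg hvo]; exact ⟨hvT, hvY⟩⟩
  simp only [hcov]
  rw [missProb]
  split_ifs with h
  · simp [h, htot]
  · simp only [h, false_or]
    have h1 := sum_prod_disjoint (fun v => stay p (part v)) (ordinary part o T S)
    rw [← h1, sub_eq_iff_eq_add, Finset.sum_filter, ← Finset.sum_add_distrib]
    refine htot.symm.trans (Finset.sum_congr rfl fun Y _ => ?_)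
    by_cases hd : Disjoint (ordinary part o T S) Y <;> simp [hd, μ]

end

/-! ### Coordinates that a short message certifies -/

/-- The bit strings of length at most `b`. -/
def shortStrings : ℕ → Finset (List Bool)
  | 0 => {[]}
  | b + 1 => {[]} ∪ ((shortStrings b).image (List.cons true) ∪ (shortStrings b).image (List.cons false))

theorem mem_shortStrings {b : ℕ} {m : List Bool} (h : m.length ≤ b) : m ∈ shortStrings b := by
  induction b generalizing m with
  | zero => simpa [shortStrings] using h
  | succ b ih =>
    cases m with
    | nil => simp [shortStrings]
    | cons c m =>
      have := ih (m := m) (by simpa using h)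
      cases c <;> simp [shortStrings, this]

theorem card_shortStrings_lt (b : ℕ) : (shortStrings b).card < 2 ^ (b + 1) := by
  induction b with
  | zero => simp [shortStrings]
  | succ b ih =>
    have h1 := Finset.card_union_le {([] : List Bool)}
      ((shortStrings b).image (List.cons true) ∪ (shortStrings b).image (List.cons false))
    have h2 := Finset.card_union_le ((shortStrings b).image (List.cons true))
      ((shortStrings b).image (List.cons false))
    have h3 := Finset.card_image_le (s := shortStrings b) (f := List.cons true)
    have h4 := Finset.card_image_le (s := shortStrings b) (f := List.cons false)
    rw [Finset.card_singleton] at h1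
    rw [shortStrings, pow_succ]
    omega

section certified

variable {n : ℕ}

open Classical in
/-- The coordinates on which all the inputs that may cause the message `m` agree. -/
def certified (κ : (Fin n → Bool) → PMF (List Bool)) (m : List Bool) : Finset (Fin n) :=
  Finset.univ.filter fun j => ∀ y y', m ∈ (κ y).support → m ∈ (κ y').support → y j = y' j

/-- The probability that the message sent on input `y` certifies the coordinate `j`. -/
def leak (κ : (Fin n → Bool) → PMF (List Bool)) (y : Fin n → Bool) (j : Fin n) : ℝ≥0∞ :=
  ∑' m, κ y m * if j ∈ certified κ m then 1 else 0

-- Compatible inputs agree on the certified coordinates, so the remaining bits determine them.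
open Classical in
theorem card_consistent_mul_le (κ : (Fin n → Bool) → PMF (List Bool)) (m : List Bool) :
    (Finset.univ.filter fun y => m ∈ (κ y).support).card * 2 ^ (certified κ m).card ≤ 2 ^ n := by
  have hK : (certified κ m).card ≤ n := by simpa using Finset.card_le_univ (certified κ m)
  have h : (Finset.univ.filter fun y => m ∈ (κ y).support).card ≤
      2 ^ (n - (certified κ m).card) := by
    rw [← Fintype.card_subtype]
    refine (Fintype.card_le_of_injective
      (fun (y : {y // m ∈ (κ y).support}) (j : {j // j ∉ certified κ m}) => y.1 j.1) ?_).trans ?_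
    · intro y y' h
      refine Subtype.ext (funext fun j => ?_)
      by_cases hj : j ∈ certified κ m
      · exact (Finset.mem_filter.1 hj).2 _ _ y.2 y'.2
      · exact congrFun h ⟨j, hj⟩
    · rw [Fintype.card_fun, Fintype.card_bool, Fintype.card_subtype_compl, Fintype.card_fin,
        Fintype.card_coe]
  calc _ ≤ 2 ^ (n - (certified κ m).card) * 2 ^ (certified κ m).card := Nat.mul_le_mul_right _ h
    _ = 2 ^ n := by rw [← pow_add, Nat.sub_add_cancel hK]

/-- Trades a count of certified coordinates for an exponential, which `card_consistent_mul_le` can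
average. -/
theorem natCast_le_add_two_pow_div (k c : ℕ) : (k : ℝ≥0∞) ≤ c + 2 ^ k / 2 ^ c := by
  rcases le_total k c with h | h
  · exact le_add_right (by exact_mod_cast h)
  · obtain ⟨d, rfl⟩ := Nat.exists_eq_add_of_le h
    rw [pow_add, mul_comm, ENNReal.mul_div_cancel_right (by simp) (by simp)]
    push_cast
    gcongr
    exact_mod_cast Nat.lt_two_pow_self.le

/-- On average over the inputs, messages of at most `b` bits certify at most `b + 2`
coordinates. -/
theorem sum_leak_le (κ : (Fin n → Bool) → PMF (List Bool)) {b : ℕ}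
    (hb : ∀ y, ∀ m ∈ (κ y).support, m.length ≤ b) :
    ∑ y, ∑ j, leak κ y j ≤ 2 ^ n * ((b : ℝ≥0∞) + 2) := by
  classical
  -- The excess over `b + 1` is charged to every possible message with the probability `κ y m`
  -- bounded by `1`; hence randomness does not help.
  set g : (Fin n → Bool) → List Bool → ℝ≥0∞ := fun y m =>
    if m ∈ (κ y).support then 2 ^ (certified κ m).card / 2 ^ (b + 1) else 0 with hg
  have h1 : ∀ y, ∑ j, leak κ y j ≤ ((b : ℝ≥0∞) + 1) + ∑ m ∈ shortStrings b, g y m := by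
    intro y
    have hz : ∀ m ∉ shortStrings b, g y m = 0 := fun m hm =>
      if_neg fun h => hm (mem_shortStrings (hb y m h))
    simp only [leak]
    rw [← tsum_eq_sum (L := SummationFilter.unconditional _) hz, ← Summable.tsum_finsetSum fun _ _ => ENNReal.summable]
    have : ((b : ℝ≥0∞) + 1) = ∑' m, κ y m * ((b : ℝ≥0∞) + 1) := by
      rw [ENNReal.tsum_mul_right, (κ y).tsum_coe, one_mul]
    rw [this, ← ENNReal.tsum_add]
    refine ENNReal.tsum_le_tsum fun m => ?_
    rw [← Finset.mul_sum, Finset.sum_boole]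
    have hc : (Finset.univ.filter fun j => j ∈ certified κ m) = certified κ m := by simp
    rw [hc]
    by_cases hm : m ∈ (κ y).support
    · simp only [hg, if_pos hm]
      calc κ y m * ((certified κ m).card : ℝ≥0∞)
          ≤ κ y m * (((b + 1 : ℕ) : ℝ≥0∞) + 2 ^ (certified κ m).card / 2 ^ (b + 1)) := by
            gcongr; exact natCast_le_add_two_pow_div _ _
        _ ≤ _ := by
            rw [mul_add]
            push_cast
            gcongr
            exact mul_le_of_le_one_left' ((κ y).coe_le_one m)
    · rw [(PMF.apply_eq_zero_iff _ _).2 hm]; simp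
  refine (Finset.sum_le_sum fun y _ => h1 y).trans ?_
  rw [Finset.sum_add_distrib, Finset.sum_comm]
  -- Each message contributes at most `2 ^ n / 2 ^ (b + 1)`, and there are fewer than `2 ^ (b + 1)`
  -- of them.
  have h2 : ∑ m ∈ shortStrings b, ∑ y, g y m ≤ 2 ^ n := by
    calc _ ≤ ∑ m ∈ shortStrings b, (2 : ℝ≥0∞) ^ n / 2 ^ (b + 1) := by
          refine Finset.sum_le_sum fun m _ => ?_
          rw [← Finset.sum_filter, Finset.sum_const, nsmul_eq_mul, ← mul_div_assoc]
          gcongr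
          exact_mod_cast card_consistent_mul_le κ m
      _ = (shortStrings b).card * ((2 : ℝ≥0∞) ^ n / 2 ^ (b + 1)) := by
          rw [Finset.sum_const, nsmul_eq_mul]
      _ ≤ 2 ^ (b + 1) * ((2 : ℝ≥0∞) ^ n / 2 ^ (b + 1)) := by
          gcongr
          exact_mod_cast (card_shortStrings_lt b).le
      _ = 2 ^ n := ENNReal.mul_div_cancel (by simp) (by simp)
  calc _ ≤ ∑ y : Fin n → Bool, ((b : ℝ≥0∞) + 1) + 2 ^ n := by gcongr
    _ = _ := by
      rw [Finset.sum_const, Finset.card_univ, Fintype.card_fun, Fintype.card_bool,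
        Fintype.card_fin, nsmul_eq_mul]
      push_cast
      ring

end certified

/-! ### Running a protocol from the middle -/

namespace Protocol

variable {p : ℕ} {W : Type*}

/-- The distribution of the message received by player `i + t`, if player `i` receives `m`. -/
def messageFrom (P : Protocol p W) (I : Instance p W) (i : ℕ) (m : List Bool) : ℕ → PMF (List Bool)
  | 0 => PMF.pure m
  | t + 1 => (P.messageFrom I i m t).bind (P.send (i + t) (I.view (i + t)))

/-- The distribution of the output, if player `i` receives `m`. -/
def outputFrom (P : Protocol p W) (I : Instance p W) (i : ℕ) (m : List Bool) : PMF (Finset W) :=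
  (P.messageFrom I i m (p - 1 - i)).bind (P.out (I.view (p - 1)))

theorem message_add (P : Protocol p W) (I : Instance p W) (i t : ℕ) :
    P.message I (i + t) = (P.message I i).bind fun m => P.messageFrom I i m t := by
  induction t with
  | zero => exact (PMF.bind_pure _).symm
  | succ t ih => rw [← add_assoc, message, ih, PMF.bind_bind]; rfl

theorem output_eq_bind (P : Protocol p W) (I : Instance p W) {i : ℕ} (hi : i < p - 1) :
    P.output I = (P.message I i).bind fun a =>
      (P.send i (I.view i) a).bind (P.outputFrom I (i + 1)) := by
  have h : i + 1 + (p - 1 - (i + 1)) = p - 1 := by omega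
  rw [output, ← h, message_add, message, PMF.bind_bind, PMF.bind_bind, h]
  rfl

theorem message_congr (P : Protocol p W) {I J : Instance p W} {i : ℕ}
    (h : ∀ t < i, I.view t = J.view t) : P.message I i = P.message J i := by
  induction i with
  | zero => rfl
  | succ i ih => rw [message, message, ih fun t ht => h t (by omega), h i (by omega)]

theorem messageFrom_congr (P : Protocol p W) {I J : Instance p W} {i : ℕ} (m : List Bool) {t : ℕ}
    (h : ∀ s < t, I.view (i + s) = J.view (i + s)) :
    P.messageFrom I i m t = P.messageFrom J i m t := by
  induction t with
  | zero => rfl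
  | succ t ih => rw [messageFrom, messageFrom, ih fun s hs => h s (by omega), h t (by omega)]

theorem outputFrom_congr (P : Protocol p W) {I J : Instance p W} {i : ℕ} (m : List Bool)
    (hi : i ≤ p - 1) (h : ∀ t, i ≤ t → t < p → I.view t = J.view t) (hp : 0 < p) :
    P.outputFrom I i m = P.outputFrom J i m := by
  rw [outputFrom, outputFrom, messageFrom_congr P (J := J) m fun s hs => h _ (by omega) (by omega),
    h (p - 1) hi (by omega)]

theorem length_le_of_commComplexity_le {P : Protocol p W} {𝓘 : Set (Instance p W)} {b : ℕ}
    (hb : P.commComplexity 𝓘 ≤ b) {I : Instance p W} (hI : I ∈ 𝓘) {i : ℕ} (h1 : 1 ≤ i)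
    (hi : i ≤ p - 1) {m : List Bool} (hm : m ∈ (P.message I i).support) : m.length ≤ b := by
  have h2 : (m.length : ℕ∞) ≤ P.commComplexity 𝓘 :=
    le_iSup₂_of_le I hI (le_iSup₂_of_le i (Finset.mem_Icc.2 ⟨h1, hi⟩)
      (le_iSup₂_of_le m hm le_rfl))
  exact_mod_cast h2.trans hb

end Protocol

/-! ### The hard instances -/

section hardInstance

variable {p n : ℕ} {W : Type*} [Fintype W] [DecidableEq W]

/-- The instance in which the elements `e i l (x i l)` with `l : Fin n` are given to player `i`,
and `o` lists the special elements. -/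
def hardInstance (part : W → Fin p) (e : ℕ → Fin n → Bool → W) (x : ℕ → Fin n → Bool) (o : ℕ → W) :
    Instance p W where
  k := p
  part := part
  V := Finset.univ.filter fun v => ∃ l, v = e (part v) l (x (part v) l)
  f := hardFun part o

variable {part : W → Fin p} {e : ℕ → Fin n → Bool → W}

theorem hardInstance_mem (x : ℕ → Fin n → Bool) {o : ℕ → W}
    (ho : ∀ T < p, (part (o T)).val = T) : hardInstance part e x o ∈ coverageInstances p W :=
  ⟨rfl, isCoverage_hardFun part o ho⟩

theorem mem_hardInstance_V (he : ∀ i < p, ∀ l c, (part (e i l c)).val = i)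
    (hinj : ∀ i < p, ∀ l c l' c', e i l c = e i l' c' → l = l' ∧ c = c')
    (x : ℕ → Fin n → Bool) (o : ℕ → W) {i : ℕ} (hi : i < p) (l : Fin n) (c : Bool) :
    e i l c ∈ (hardInstance part e x o).V ↔ x i l = c := by
  simp only [hardInstance, Finset.mem_filter, Finset.mem_univ, true_and, he i hi]
  constructor
  · rintro ⟨l', h⟩
    obtain ⟨rfl, rfl⟩ := hinj i hi _ _ _ _ h
    rfl
  · rintro rfl
    exact ⟨l, rfl⟩

/-- Keeping `x` and `o` as independent parameters lets one player's input vary while all other views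
stay fixed. -/
theorem hardInstance_view_congr {x x' : ℕ → Fin n → Bool} {o o' : ℕ → W} {i : ℕ} (hi : i < p)
    (ho : ∀ T < p, (part (o T)).val = T) (ho' : ∀ T < p, (part (o' T)).val = T)
    (hx : x i = x' i) (h : ∀ T < i, o T = o' T) :
    (hardInstance part e x o).view i = (hardInstance part e x' o').view i := by
  have h1 : ((hardInstance part e x o).V.filter fun v => (part v).val = i)
      = (hardInstance part e x' o').V.filter fun v => (part v).val = i := by
    ext v
    simp only [hardInstance, Finset.mem_filter, Finset.mem_univ, true_and]
    refine and_congr_left fun hv => ?_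
    rw [hv, hx]
  have h2 : (fun S : Finset W => hardFun part o (S.filter fun v => (part v).val ≤ i))
      = fun S => hardFun part o' (S.filter fun v => (part v).val ≤ i) :=
    funext fun S => hardFun_congr part hi ho ho' h fun v hv => (Finset.mem_filter.1 hv).2
  simp only [Instance.view]
  congr 1

/-- What player `i` sends on input `y`, if she receives `a` and everything else is given by `x`
and `o`. -/
def sendKernel (P : Protocol p W) (part : W → Fin p) (e : ℕ → Fin n → Bool → W)
    (x : ℕ → Fin n → Bool) (o : ℕ → W) (i : ℕ) (a : List Bool) (y : Fin n → Bool) :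
    PMF (List Bool) :=
  P.send i ((hardInstance part e (Function.update x i y) o).view i) a

/-- The probability that the message of player `i` certifies the coordinate `j`. -/
def leakAt (P : Protocol p W) (part : W → Fin p) (e : ℕ → Fin n → Bool → W)
    (x : ℕ → Fin n → Bool) (o : ℕ → W) (i : ℕ) (j : Fin n) : ℝ≥0∞ :=
  ∑' a, P.message (hardInstance part e x o) i a * leak (sendKernel P part e x o i a) (x i) j

theorem sendKernel_congr (P : Protocol p W) {x x' : ℕ → Fin n → Bool} {o o' : ℕ → W} {i : ℕ}
    (hi : i < p) (ho : ∀ T < p, (part (o T)).val = T) (ho' : ∀ T < p, (part (o' T)).val = T)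
    (h : ∀ T < i, o T = o' T) (a : List Bool) :
    sendKernel P part e x o i a = sendKernel P part e x' o' i a := by
  funext y
  rw [sendKernel, sendKernel, hardInstance_view_congr hi ho ho' _ h]
  simp

theorem message_hardInstance_congr (P : Protocol p W) {x x' : ℕ → Fin n → Bool} {o o' : ℕ → W}
    {i : ℕ} (hi : i ≤ p) (ho : ∀ T < p, (part (o T)).val = T)
    (ho' : ∀ T < p, (part (o' T)).val = T) (hx : ∀ T < i, x T = x' T) (h : ∀ T < i, o T = o' T) :
    P.message (hardInstance part e x o) i = P.message (hardInstance part e x' o') i :=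
  P.message_congr fun t ht => hardInstance_view_congr (by omega) ho ho' (hx t ht)
    fun T hT => h T (by omega)

theorem leakAt_congr (P : Protocol p W) {x x' : ℕ → Fin n → Bool} {o o' : ℕ → W} {i : ℕ}
    (hi : i < p) (ho : ∀ T < p, (part (o T)).val = T) (ho' : ∀ T < p, (part (o' T)).val = T)
    (hx : ∀ T ≤ i, x T = x' T) (h : ∀ T < i, o T = o' T) (j : Fin n) :
    leakAt P part e x o i j = leakAt P part e x' o' i j := by
  rw [leakAt, leakAt, message_hardInstance_congr P hi.le ho ho' (fun T hT => hx T hT.le) h,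
    hx i le_rfl]
  simp only [sendKernel_congr P (x := x) (x' := x') hi ho ho' h]

/-- If the output is always feasible, then the element of player `i` that belongs to the
coordinate `j` can be put out only if her message certifies `j`. -/
theorem toOuterMeasure_mem_le_leakAt (P : Protocol p W)
    (hfeas : ∀ I ∈ coverageInstances p W, ∀ S ∈ (P.output I).support, S ∈ I.feasible)
    (he : ∀ i < p, ∀ l c, (part (e i l c)).val = i)
    (hinj : ∀ i < p, ∀ l c l' c', e i l c = e i l' c' → l = l' ∧ c = c')
    (x : ℕ → Fin n → Bool) {o : ℕ → W} (ho : ∀ T < p, (part (o T)).val = T) {i : ℕ}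
    (hi : i < p - 1) (j : Fin n) :
    (P.output (hardInstance part e x o)).toOuterMeasure {S | e i j (x i j) ∈ S} ≤
      leakAt P part e x o i j := by
  classical
  set A : Set (Finset W) := {S | e i j (x i j) ∈ S} with hA
  have hself : P.send i ((hardInstance part e x o).view i)
      = fun a => sendKernel P part e x o i a (x i) := by
    funext a
    rw [sendKernel, Function.update_eq_self]
  rw [P.output_eq_bind _ hi, PMF.toOuterMeasure_bind_apply, leakAt]
  refine ENNReal.tsum_le_tsum fun a => ?_
  by_cases ha : a ∈ (P.message (hardInstance part e x o) i).support
  swap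
  · rw [(PMF.apply_eq_zero_iff _ _).2 ha]; simp
  gcongr
  rw [PMF.toOuterMeasure_bind_apply, leak, hself]
  refine ENNReal.tsum_le_tsum fun m => ?_
  by_cases hm : m ∈ (sendKernel P part e x o i a (x i)).support
  swap
  · rw [(PMF.apply_eq_zero_iff _ _).2 hm]; simp
  gcongr
  split_ifs with hj
  · calc _ ≤ (P.outputFrom (hardInstance part e x o) (i + 1) m).toOuterMeasure Set.univ :=
        MeasureTheory.measure_mono (Set.subset_univ _)
      _ ≤ 1 := by
        rw [(PMF.toOuterMeasure_apply_eq_one_iff _ _).2 (Set.subset_univ _)]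
  · rw [nonpos_iff_eq_zero, PMF.toOuterMeasure_apply_eq_zero_iff, Set.disjoint_left]
    intro S hS hSA
    apply hj
    have key : ∀ y, m ∈ (sendKernel P part e x o i a y).support → y j = x i j := by
      intro y hy
      -- With the input of player `i` replaced by `y` and `o` kept, she still receives `a` and may
      -- send `m`, and the later players see no change. So `S` must be feasible there too.
      have hout : S ∈ (P.output (hardInstance part e (Function.update x i y) o)).support := by
        rw [P.output_eq_bind _ hi, PMF.mem_support_bind_iff]
        refine ⟨a, ?_, ?_⟩
        · rwa [message_hardInstance_congr P (x' := x) (by omega) ho ho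
            (fun T hT => Function.update_of_ne hT.ne _ _) fun _ _ => rfl]
        · rw [PMF.mem_support_bind_iff]
          refine ⟨m, hy, ?_⟩
          rwa [P.outputFrom_congr (J := hardInstance part e x o) m (by omega) _ (by omega)]
          intro t ht htp
          exact hardInstance_view_congr htp ho ho
            (Function.update_of_ne (by omega) _ _) fun _ _ => rfl
      have hf := hfeas _ (hardInstance_mem _ ho) S hout
      have hV := Finset.mem_powerset.1 (Finset.mem_filter.1 hf).1 hSA
      rw [mem_hardInstance_V he hinj _ _ (by omega), Function.update_self] at hV
      exact hV
    simp only [certified, Finset.mem_filter, Finset.mem_univ, true_and]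
    intro y y' hy hy'
    rw [key y hy, key y' hy']

/-- The special elements chosen by the coordinates `j`. -/
def specials (e : ℕ → Fin n → Bool → W) (x : ℕ → Fin n → Bool) (j : ℕ → Fin n) (i : ℕ) : W :=
  e i (j i) (x i (j i))

/-- What player `i` receives, and her kernel, depend only on the inputs and special elements of
earlier players. For each received message, `sum_leak_le` thus applies to one fixed kernel. -/
theorem sum_leakAt_update_le (P : Protocol p W) {b : ℕ}
    (hb : P.commComplexity (coverageInstances p W) ≤ b)
    (he : ∀ i < p, ∀ l c, (part (e i l c)).val = i)
    (x : ℕ → Fin n → Bool) (j : ℕ → Fin n) {i : ℕ} (hi : i < p - 1) :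
    ∑ y, ∑ l, leakAt P part e (Function.update x i y)
        (specials e (Function.update x i y) (Function.update j i l)) i l ≤
      2 ^ n * ((b : ℝ≥0∞) + 2) := by
  have ho : ∀ x j, ∀ T < p, (part (specials e x j T)).val = T := fun x j T hT => he T hT _ _
  have hu : ∀ y l, leakAt P part e (Function.update x i y)
        (specials e (Function.update x i y) (Function.update j i l)) i l
      = ∑' a, P.message (hardInstance part e x (specials e x j)) i a *
        leak (sendKernel P part e x (specials e x j) i a) y l := by
    intro y l
    have hs : ∀ T < i, specials e (Function.update x i y) (Function.update j i l) T
        = specials e x j T := by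
      intro T hT
      simp [specials, Function.update_of_ne hT.ne]
    rw [leakAt, message_hardInstance_congr P (x' := x) (by omega) (ho _ _) (ho x j)
      (fun T hT => Function.update_of_ne hT.ne _ _) hs, Function.update_self]
    simp only [sendKernel_congr P (x' := x) (show i < p by omega) (ho _ _) (ho x j) hs]
  simp only [hu]
  simp only [← Summable.tsum_finsetSum fun _ _ => ENNReal.summable, ← Finset.mul_sum]
  calc _ ≤ ∑' a, P.message (hardInstance part e x (specials e x j)) i a *
        (2 ^ n * ((b : ℝ≥0∞) + 2)) := by
        refine ENNReal.tsum_le_tsum fun a => ?_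
        by_cases ha : a ∈ (P.message (hardInstance part e x (specials e x j)) i).support
        swap
        · rw [(PMF.apply_eq_zero_iff _ _).2 ha]; simp
        gcongr
        refine sum_leak_le _ fun y m hm => ?_
        refine Protocol.length_le_of_commComplexity_le hb
          (hardInstance_mem (e := e) (Function.update x i y) (ho x j)) (i := i + 1)
          (by omega) (by omega) ?_
        rw [Protocol.message, PMF.mem_support_bind_iff]
        refine ⟨a, ?_, hm⟩
        rwa [message_hardInstance_congr P (x' := x) (by omega) (ho x j) (ho x j)
          (fun T hT => Function.update_of_ne hT.ne _ _) fun _ _ => rfl]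
    _ = _ := by rw [ENNReal.tsum_mul_right, PMF.tsum_coe, one_mul]

/-- There are inputs and special elements for which no player certifies her special element with
a probability above average. -/
theorem exists_leakAt_le (P : Protocol p W) {b : ℕ} (hn : 0 < n)
    (hb : P.commComplexity (coverageInstances p W) ≤ b)
    (he : ∀ i < p, ∀ l c, (part (e i l c)).val = i) {t : ℕ} (ht : t ≤ p - 1) :
    ∃ (x : ℕ → Fin n → Bool) (j : ℕ → Fin n), ∀ i < t,
      leakAt P part e x (specials e x j) i (j i) ≤ ((b : ℝ≥0∞) + 2) / n := by
  have ho : ∀ x j, ∀ T < p, (part (specials e x j T)).val = T := fun x j T hT => he T hT _ _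
  induction t with
  | zero => exact ⟨fun _ _ => true, fun _ => ⟨0, hn⟩, by simp⟩
  | succ t ih =>
    obtain ⟨x, j, h⟩ := ih (by omega)
    have hsum := sum_leakAt_update_le P hb he x j (show t < p - 1 by omega)
    obtain ⟨y, l, hyl⟩ : ∃ y l, leakAt P part e (Function.update x t y)
        (specials e (Function.update x t y) (Function.update j t l)) t l ≤
          ((b : ℝ≥0∞) + 2) / n := by
      -- Averaging over the `2 ^ n * n` pairs `(y, l)`.
      by_contra! hcon
      rw [← Fintype.sum_prod_type'] at hsum
      have hne : (Finset.univ : Finset ((Fin n → Bool) × Fin n)).Nonempty :=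
        ⟨(fun _ => true, ⟨0, hn⟩), Finset.mem_univ _⟩
      have hlt := ENNReal.sum_lt_sum_of_nonempty hne fun z _ => hcon z.1 z.2
      refine absurd (hlt.trans_le hsum) (not_lt.2 ?_)
      rw [Finset.sum_const, Finset.card_univ, Fintype.card_prod, Fintype.card_fun,
        Fintype.card_bool, Fintype.card_fin, nsmul_eq_mul]
      push_cast
      rw [mul_assoc, ENNReal.mul_div_cancel (by exact_mod_cast hn.ne') (by simp)]
    refine ⟨Function.update x t y, Function.update j t l, fun i hi => ?_⟩
    rcases Nat.lt_succ_iff_lt_or_eq.1 hi with hi | rfl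
    · rw [Function.update_of_ne hi.ne]
      -- The bounds for earlier players survive, as they do not see the choices of player `t`.
      refine le_of_eq_of_le ?_ (h i hi)
      refine leakAt_congr P (by omega) (ho _ _) (ho _ _) ?_ ?_ _
      · exact fun T hT => Function.update_of_ne (by omega) _ _
      · intro T hT
        have : T ≠ t := by omega
        simp [specials, Function.update_of_ne this]
    · rwa [Function.update_self]

end hardInstance

/-! ### The lower bound -/

section

variable {p : ℕ} {W : Type*}

theorem coverageInstances_subset_equalInstances [DecidableEq W] :
    coverageInstances p W ⊆ equalInstances p W := by
  classical
  rintro I ⟨hk, m, a, cover, ha, hf⟩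
  refine ⟨hk, fun S => ?_, fun S T hST => ?_, fun X Y hXY v hv => ?_⟩
  · rw [hf]; exact Finset.sum_nonneg fun u _ => ha u
  · rw [hf, hf]
    exact Finset.sum_le_sum_of_subset_of_nonneg (Finset.biUnion_subset_biUnion_of_subset_left _ hST)
      fun u _ _ => ha u
  · have key : ∀ Z : Finset W, I.f (insert v Z) - I.f Z
        = ∑ u ∈ cover v \ Z.biUnion cover, a u := by
      intro Z
      rw [hf, hf, Finset.biUnion_insert, ← Finset.sdiff_union_self_eq_union,
        Finset.sum_union Finset.sdiff_disjoint, add_sub_cancel_right]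
    rw [key, key]
    exact Finset.sum_le_sum_of_subset_of_nonneg
      (Finset.sdiff_subset_sdiff le_rfl (Finset.biUnion_subset_biUnion_of_subset_left _ hXY))
      fun u _ _ => ha u

theorem equalInstances_subset_allInstances [DecidableEq W] (hp : 0 < p) :
    equalInstances p W ⊆ allInstances p W :=
  fun _ hI => ⟨hp.trans_eq hI.1.symm, hI.2⟩

theorem Protocol.HasApproxGuarantee.mono [Fintype W] {P : Protocol p W}
    {𝓘 𝓙 : Set (Instance p W)} {α : ℝ} (h : P.HasApproxGuarantee 𝓘 α) (hs : 𝓙 ⊆ 𝓘) :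
    P.HasApproxGuarantee 𝓙 α := fun I hI => h I (hs hI)

theorem Protocol.HasApproxGuarantee.of_le [Fintype W] {P : Protocol p W}
    {𝓘 : Set (Instance p W)} {α β : ℝ} (h : P.HasApproxGuarantee 𝓘 α) (hβ : β ≤ α)
    (h0 : ∀ I ∈ 𝓘, 0 ≤ I.f ∅) : P.HasApproxGuarantee 𝓘 β := by
  refine fun I hI => ⟨(h I hI).1, le_trans ?_ (h I hI).2⟩
  have : I.f ∅ ≤ I.opt := Finset.le_sup' I.f (by simp [Instance.feasible])
  exact mul_le_mul_of_nonneg_right hβ ((h0 I hI).trans this)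

theorem Protocol.commComplexity_mono (P : Protocol p W) {𝓘 𝓙 : Set (Instance p W)} (hs : 𝓙 ⊆ 𝓘) :
    P.commComplexity 𝓙 ≤ P.commComplexity 𝓘 :=
  biSup_mono fun _ hI => hs hI

theorem sum_toReal_eq_one {α : Type*} [Fintype α] (μ : PMF α) : ∑ a, (μ a).toReal = 1 := by
  rw [← ENNReal.toReal_sum fun a _ => μ.apply_ne_top a, ← tsum_fintype (L := .unconditional _), μ.tsum_coe,
    ENNReal.toReal_one]

/-- The instance in which only the element `w` has any value, and belongs to the first player. -/
def singletonInstance [DecidableEq W] (hp : 0 < p) (w : W) (V : Finset W) : Instance p W where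
  k := p
  part := fun _ => ⟨0, hp⟩
  V := V
  f := fun S => if w ∈ S then 1 else 0

theorem singletonInstance_mem [DecidableEq W] (hp : 0 < p) (w : W) (V : Finset W) :
    singletonInstance hp w V ∈ coverageInstances p W := by
  refine ⟨rfl, isCoverage_of_fintype (U := Unit) (fun _ => 1) (fun v _ => v = w)
    (fun _ => zero_le_one) fun S => ?_⟩
  by_cases h : w ∈ S <;> simp [singletonInstance, h]

theorem one_le_opt_singletonInstance [DecidableEq W] (hp : 0 < p) (w : W) :
    1 ≤ (singletonInstance hp w {w}).opt := by
  have h : {w} ∈ (singletonInstance hp w {w}).feasible :=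
    Finset.mem_filter.2 ⟨Finset.mem_powerset_self _, (Finset.card_singleton w).trans_le hp⟩
  refine le_trans ?_ (Finset.le_sup' _ h)
  simp [singletonInstance]

variable [Fintype W] [DecidableEq W]

/-- Serves to bound `ε` by `1` when the ground set is too small for the hard instances. -/
theorem approx_le_one (hp : 0 < p) (w : W) {P : Protocol p W} {α : ℝ} (hα : 0 < α)
    (h : P.HasApproxGuarantee (coverageInstances p W) α) : α ≤ 1 := by
  have h1 := (h _ (singletonInstance_mem hp w {w})).2
  have h2 := one_le_opt_singletonInstance hp w
  calc α ≤ α * (singletonInstance hp w {w}).opt := le_mul_of_one_le_right hα.le h2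
    _ ≤ _ := h1
    _ ≤ ∑ S, (P.output (singletonInstance hp w {w}) S).toReal := by
      refine Finset.sum_le_sum fun S _ => mul_le_of_le_one_right ENNReal.toReal_nonneg ?_
      simp only [singletonInstance]
      split_ifs <;> norm_num
    _ = 1 := sum_toReal_eq_one _

/-- Without communication nothing can be put out. -/
theorem one_le_commComplexity (hp : 2 ≤ p) (w : W) {P : Protocol p W} {α : ℝ} (hα : 0 < α)
    (h : P.HasApproxGuarantee (coverageInstances p W) α) :
    1 ≤ P.commComplexity (coverageInstances p W) := by
  have hp0 : 0 < p := by omega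
  rw [Order.one_le_iff_ne_zero]
  intro h0
  set I := singletonInstance hp0 w {w} with hI
  set J := singletonInstance hp0 w ∅ with hJ
  have hnil : ∀ V, P.message (singletonInstance hp0 w V) (p - 1) = PMF.pure [] := by
    intro V
    have hs : ∀ m, m ∈ (P.message (singletonInstance hp0 w V) (p - 1)).support → m = [] := by
      intro m hm
      have := Protocol.length_le_of_commComplexity_le (b := 0) (by simp [h0])
        (singletonInstance_mem hp0 w V) (by omega) le_rfl hm
      exact List.length_eq_zero_iff.1 (by omega)
    set μ := P.message (singletonInstance hp0 w V) (p - 1)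
    have h1 : μ [] = 1 := by
      rw [PMF.apply_eq_one_iff]
      refine Set.Subset.antisymm (fun m hm => hs m hm) ?_
      obtain ⟨m, hm⟩ := μ.support_nonempty
      rintro _ rfl
      rwa [hs m hm] at hm
    ext m
    rw [PMF.pure_apply]
    split_ifs with hm
    · rw [hm, h1]
    · exact (PMF.apply_eq_zero_iff _ _).2 fun h' => hm (hs m h')
  -- Only player `0` could tell the two instances apart, and she is not the last player.
  have hview : I.view (p - 1) = J.view (p - 1) := by
    have : (0 : ℕ) ≠ p - 1 := by omega
    simp [Instance.view, hI, hJ, singletonInstance, this]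
  have hout : P.output I = P.output J := by
    rw [Protocol.output, Protocol.output, hI, hJ, hnil, hnil, ← hI, ← hJ, hview]
  obtain ⟨hJf, -⟩ := h J (singletonInstance_mem hp0 w ∅)
  obtain ⟨-, hIv⟩ := h I (singletonInstance_mem hp0 w {w})
  have hzero : ∑ S : Finset W, (P.output I S).toReal * I.f S = 0 := by
    refine Finset.sum_eq_zero fun S _ => ?_
    by_cases hS : S ∈ (P.output I).support
    · rw [hout] at hS
      have := Finset.mem_powerset.1 (Finset.mem_filter.1 (hJf S hS)).1
      have hw : w ∉ S := fun hw => by simpa [hJ, singletonInstance] using this hw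
      simp [hI, singletonInstance, hw]
    · rw [(PMF.apply_eq_zero_iff _ _).2 hS]; simp
  rw [hzero] at hIv
  have := one_le_opt_singletonInstance hp0 w
  nlinarith

/-- A protocol that is better than `ratio p` puts out a special element with positive
probability. -/
theorem mul_ratio_le_toReal (hp : 2 ≤ p) {P : Protocol p W} {ε : ℝ} (hε : 0 < ε)
    (h : P.HasApproxGuarantee (coverageInstances p W) (ratio p * (1 + ε))) {n : ℕ}
    {part : W → Fin p} {e : ℕ → Fin n → Bool → W}
    (he : ∀ i < p, ∀ l c, (part (e i l c)).val = i)
    (hinj : ∀ i < p, ∀ l c l' c', e i l c = e i l' c' → l = l' ∧ c = c')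
    (x : ℕ → Fin n → Bool) (j : ℕ → Fin n) :
    ratio p * ε ≤ ((P.output (hardInstance part e x (specials e x j))).toOuterMeasure
      {S | ∃ i < p - 1, specials e x j i ∈ S}).toReal := by
  classical
  have ho : ∀ T < p, (part (specials e x j T)).val = T := fun T hT => he T hT _ _
  have hr := half_le_ratio (show 1 ≤ p by omega)
  set o := specials e x j with hodef
  set I := hardInstance part e x o with hI
  set A : Set (Finset W) := {S | ∃ i < p - 1, o i ∈ S} with hA
  obtain ⟨hfeas, hval⟩ := h I (hardInstance_mem x ho)
  have hopt : 1 ≤ I.opt := by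
    have hO : (Finset.range p).image o ∈ I.feasible := by
      refine Finset.mem_filter.2 ⟨Finset.mem_powerset.2 fun v hv => ?_, ?_⟩
      · obtain ⟨T, hT, rfl⟩ := Finset.mem_image.1 hv
        rw [hodef, specials, hI, mem_hardInstance_V he hinj _ _ (Finset.mem_range.1 hT)]
      · exact Finset.card_image_le.trans (Finset.card_range p).le
    refine le_of_eq_of_le ?_ (Finset.le_sup' I.f hO)
    exact (hardFun_eq_one (by omega) part o fun T hT =>
      Finset.mem_image_of_mem o (Finset.mem_range.2 hT)).symm
  -- Sets in `A` have value at most `1`, the other possible outputs at most `ratio p`.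
  have hub : ∑ S, (P.output I S).toReal * I.f S ≤
      ratio p + ((P.output I).toOuterMeasure A).toReal := by
    rw [PMF.toOuterMeasure_apply_fintype, ENNReal.toReal_sum]
    swap
    · intro S _
      by_cases hS : S ∈ A <;> simp [hS, PMF.apply_ne_top]
    rw [← mul_one (ratio p), ← sum_toReal_eq_one (P.output I), Finset.mul_sum,
      ← Finset.sum_add_distrib]
    refine Finset.sum_le_sum fun S _ => ?_
    by_cases hS : S ∈ (P.output I).support
    · by_cases hSA : S ∈ A
      · rw [Set.indicator_of_mem hSA]
        have h1 : I.f S ≤ 1 := hardFun_le_one (by omega) part o S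
        have h2 : 0 ≤ (P.output I S).toReal := ENNReal.toReal_nonneg
        nlinarith
      · rw [Set.indicator_of_notMem hSA, ENNReal.toReal_zero, add_zero, mul_comm (ratio p)]
        refine mul_le_mul_of_nonneg_left ?_ ENNReal.toReal_nonneg
        refine hardFun_le_ratio hp part o (Finset.mem_filter.1 (hfeas S hS)).2 ?_
        exact fun T hT hTS => hSA ⟨T, hT, hTS⟩
    · simp [(PMF.apply_eq_zero_iff _ _).2 hS, Set.indicator_apply]
  have h1 : ratio p * (1 + ε) ≤ ratio p * (1 + ε) * I.opt :=
    le_mul_of_one_le_right (by positivity) hopt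
  linarith

/-- The upper bound comes from a union bound over the first `p - 1` special elements, the lower
bound from `mul_ratio_le_toReal` and `half_le_ratio`. -/
theorem half_mul_le_of_approx (hp : 2 ≤ p) {P : Protocol p W} {ε : ℝ} (hε : 0 < ε)
    (h : P.HasApproxGuarantee (coverageInstances p W) (ratio p * (1 + ε))) {b n : ℕ} (hn : 0 < n)
    (hb : P.commComplexity (coverageInstances p W) ≤ b) (hcard : p * (n * 2) ≤ Fintype.card W) :
    ε / 2 * n ≤ p * (b + 2) := by
  obtain ⟨g⟩ : Nonempty (Fin p × Fin n × Bool ↪ W) :=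
    Function.Embedding.nonempty_of_card_le (by simpa using hcard)
  have hp0 : 0 < p := by omega
  -- Elements outside the range of `g` are put into block `0`; no player ever receives them.
  set part : W → Fin p := Function.extend g Prod.fst fun _ => ⟨0, hp0⟩ with hpart
  set e : ℕ → Fin n → Bool → W := fun i l c => g (if h : i < p then ⟨i, h⟩ else ⟨0, hp0⟩, l, c)
    with hedef
  have he : ∀ i < p, ∀ l c, (part (e i l c)).val = i := by
    intro i hi l c
    rw [hpart, hedef, g.injective.extend_apply]
    simp [hi]
  have hinj : ∀ i < p, ∀ l c l' c', e i l c = e i l' c' → l = l' ∧ c = c' := by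
    intro i _ l c l' c' h
    simpa using g.injective h
  obtain ⟨x, j, hx⟩ := exists_leakAt_le P hn hb he le_rfl
  have ho : ∀ T < p, (part (specials e x j T)).val = T := fun T hT => he T hT _ _
  have hlow := mul_ratio_le_toReal hp hε h he hinj x j
  set μ := (P.output (hardInstance part e x (specials e x j))).toOuterMeasure
  have hup : μ {S | ∃ i < p - 1, specials e x j i ∈ S} ≤ p * (((b : ℝ≥0∞) + 2) / n) := by
    have hU : {S | ∃ i < p - 1, specials e x j i ∈ S}
        = ⋃ i ∈ Finset.range (p - 1), {S : Finset W | specials e x j i ∈ S} := by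
      ext S; simp
    rw [hU]
    refine (MeasureTheory.measure_biUnion_finset_le _ _).trans ?_
    calc _ ≤ ∑ i ∈ Finset.range (p - 1), ((b : ℝ≥0∞) + 2) / n := by
          refine Finset.sum_le_sum fun i hi => ?_
          have hi := Finset.mem_range.1 hi
          exact (toOuterMeasure_mem_le_leakAt P (fun I hI => (h I hI).1) he hinj x ho hi
            (j i)).trans (hx i hi)
      _ = (p - 1 : ℕ) * (((b : ℝ≥0∞) + 2) / n) := by
          rw [Finset.sum_const, Finset.card_range, nsmul_eq_mul]
      _ ≤ _ := by gcongr; exact Nat.sub_le _ _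
  have hn' : (0 : ℝ) < n := by exact_mod_cast hn
  have htop : (p : ℝ≥0∞) * (((b : ℝ≥0∞) + 2) / n) ≠ ⊤ :=
    ENNReal.mul_ne_top (by simp) (ENNReal.div_ne_top (by simp) (by exact_mod_cast hn.ne'))
  have hup' := ENNReal.toReal_mono htop hup
  have hval : ((p : ℝ≥0∞) * (((b : ℝ≥0∞) + 2) / n)).toReal = p * (b + 2) / n := by
    rw [ENNReal.toReal_mul, ENNReal.toReal_div, ENNReal.toReal_add (by simp) (by simp)]
    simp [mul_div_assoc]
  rw [hval] at hup'
  have hr := half_le_ratio (show 1 ≤ p by omega)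
  rw [← le_div_iff₀ hn']
  refine le_trans ?_ (hlow.trans hup')
  nlinarith

theorem le_commComplexity_coverageInstances (hp : 2 ≤ p) {P : Protocol p W} {ε : ℝ} (hε : 0 < ε)
    (h : P.HasApproxGuarantee (coverageInstances p W) (ratio p * (1 + ε))) :
    ENNReal.ofReal (1 / 24 * ((Fintype.card W : ℝ) * ε / (p : ℝ) ^ 3)) ≤
      (P.commComplexity (coverageInstances p W) : ℝ≥0∞) := by
  rcases isEmpty_or_nonempty W with hW | ⟨⟨w⟩⟩
  · simp
  have hr := half_le_ratio (show 1 ≤ p by omega)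
  have hα : 0 < ratio p * (1 + ε) := by positivity
  have h1 := one_le_commComplexity hp w hα h
  have hle1 := approx_le_one (by omega) w hα h
  have hε1 : ε ≤ 1 := by nlinarith
  generalize hcc : P.commComplexity (coverageInstances p W) = cc at h1 ⊢
  cases cc with
  | top => simp
  | coe b =>
    have hb1 : 1 ≤ b := by exact_mod_cast h1
    have hb1' : (1 : ℝ) ≤ b := by exact_mod_cast hb1
    have hp2 : (2 : ℝ) ≤ p := by exact_mod_cast hp
    rw [ENat.toENNReal_coe, ENNReal.ofReal_le_natCast]
    rw [← mul_div_assoc, div_le_iff₀ (by positivity)]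
    set N := Fintype.card W
    set n := N / (p * 2) with hndef
    have hdiv : N < p * 2 * (n + 1) := by
      have := Nat.lt_mul_div_succ N (show 0 < p * 2 by omega)
      simpa [hndef] using this
    have hdiv' : (N : ℝ) ≤ p * 2 * (n + 1) := by exact_mod_cast hdiv.le
    have hpp : (p : ℝ) ^ 2 ≤ (p : ℝ) ^ 3 := pow_le_pow_right₀ (by linarith) (by norm_num)
    have hp1 : (p : ℝ) ≤ (p : ℝ) ^ 2 := by nlinarith
    have hNε : (N : ℝ) * ε ≤ p * 2 * (n + 1) * ε := by gcongr
    -- Rounding gives `N ≤ 2 * p * (n + 1)`, whence `24 = 2 * 12`. The `12` comes from `b + 2 ≤ 3 *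
    -- b`, which needs `b ≥ 1`, and from `n + 1 ≤ 2 * n`; if `n = 0`, then `ε ≤ 1` suffices.
    suffices hmain : (n + 1) * ε ≤ 12 * p * b by
      have a1 : (p * 2 * ((n + 1) * ε) : ℝ) ≤ p * 2 * (12 * p * b) := by gcongr
      have a2 : (b : ℝ) * p ^ 2 ≤ b * p ^ 3 := by gcongr
      nlinarith
    rcases Nat.eq_zero_or_pos n with hn | hn
    · rw [hn]
      push_cast
      nlinarith
    · have h2 := half_mul_le_of_approx hp hε h hn hcc.le (by
        rw [mul_comm n 2, ← mul_assoc]; exact Nat.mul_div_le N (p * 2))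
      have h3 : (p : ℝ) * (b + 2) ≤ p * (3 * b) := by gcongr; linarith
      have hn1 : (1 : ℝ) ≤ n := by exact_mod_cast hn
      have h4 : 1 * ε ≤ n * ε := by gcongr
      nlinarith

theorem le_commComplexity_of_subset (hp : 2 ≤ p) {P : Protocol p W} {ε : ℝ} (hε : 0 < ε)
    {𝓘 : Set (Instance p W)} (hs : coverageInstances p W ⊆ 𝓘)
    (h : P.HasApproxGuarantee 𝓘 (ratio p * (1 + ε))) :
    ENNReal.ofReal (1 / 24 * ((Fintype.card W : ℝ) * ε / (p : ℝ) ^ 3)) ≤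
      (P.commComplexity 𝓘 : ℝ≥0∞) :=
  (le_commComplexity_coverageInstances hp hε (h.mono hs)).trans
    (ENat.toENNReal_mono (P.commComplexity_mono hs))

end

end MaxCard

end

theorem theorem3 :
    ∃ c : ℝ, 0 < c ∧
      (∀ ε : ℝ, 0 < ε → ∀ p : ℕ, 2 ≤ p →
        ∀ (W : Type u) [Fintype W] [DecidableEq W] (P : MaxCard.Protocol p W),
          (P.HasApproxGuarantee (MaxCard.allInstances p W) (MaxCard.ratio p * (1 + ε)) →
            ENNReal.ofReal (c * ((Fintype.card W : ℝ) * ε / (p : ℝ) ^ 3)) ≤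
              (P.commComplexity (MaxCard.allInstances p W) : ℝ≥0∞)) ∧
          (P.HasApproxGuarantee (MaxCard.coverageInstances p W) (MaxCard.ratio p * (1 + ε)) →
            ENNReal.ofReal (c * ((Fintype.card W : ℝ) * ε / (p : ℝ) ^ 3)) ≤
              (P.commComplexity (MaxCard.coverageInstances p W) : ℝ≥0∞))) ∧
      Tendsto MaxCard.ratio atTop (𝓝 (1 / 2)) ∧
      (∀ ε : ℝ, 0 < ε → ∃ p₀ : ℕ, 2 ≤ p₀ ∧ ∀ p : ℕ, p₀ ≤ p →
        ∀ (W : Type u) [Fintype W] [DecidableEq W] (P : MaxCard.Protocol p W),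
          (P.HasApproxGuarantee (MaxCard.equalInstances p W) (1 / 2 + ε) →
            ENNReal.ofReal (c * ((Fintype.card W : ℝ) * ε / (p : ℝ) ^ 3)) ≤
              (P.commComplexity (MaxCard.equalInstances p W) : ℝ≥0∞)) ∧
          (P.HasApproxGuarantee (MaxCard.coverageInstances p W) (1 / 2 + ε) →
            ENNReal.ofReal (c * ((Fintype.card W : ℝ) * ε / (p : ℝ) ^ 3)) ≤
              (P.commComplexity (MaxCard.coverageInstances p W) : ℝ≥0∞))) := by
  refine ⟨1 / 24, by norm_num, fun ε hε p hp W _ _ P => ⟨fun h => ?_, fun h => ?_⟩,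
    MaxCard.tendsto_ratio, fun ε hε => ?_⟩
  · exact MaxCard.le_commComplexity_of_subset hp hε
      (MaxCard.coverageInstances_subset_equalInstances.trans
        (MaxCard.equalInstances_subset_allInstances (by omega))) h
  · exact MaxCard.le_commComplexity_of_subset hp hε subset_rfl h
  · have hlim : ∀ᶠ p in atTop, MaxCard.ratio p < (1 / 2 + ε) / (1 + ε) := by
      refine MaxCard.tendsto_ratio.eventually_lt_const ?_
      rw [lt_div_iff₀ (by positivity)]
      linarith
    obtain ⟨p₁, hp₁⟩ := eventually_atTop.1 hlim
    refine ⟨max 2 p₁, le_max_left _ _, fun p hp W _ _ P => ?_⟩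
    have hp2 : 2 ≤ p := (le_max_left _ _).trans hp
    have hratio : MaxCard.ratio p * (1 + ε) ≤ 1 / 2 + ε :=
      ((lt_div_iff₀ (by positivity)).1 (hp₁ p ((le_max_right _ _).trans hp))).le
    have hsub := MaxCard.coverageInstances_subset_equalInstances (p := p) (W := W)
    exact ⟨fun h => MaxCard.le_commComplexity_of_subset hp2 hε hsub
        (h.of_le hratio fun I hI => hI.2.1 ∅),
      fun h => MaxCard.le_commComplexity_of_subset hp2 hε subset_rfl
        (h.of_le hratio fun I hI => (hsub hI).2.1 ∅)⟩
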